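/- **Game.** Two players $i=1,2$ play over stages $t=1,\dots,T$; $-i$ is the player other than $i$. Player $i$ has a private type $x_t^i\in\mathbb R^{n_i}$ and takes an action $u_t^i\in\mathbb R^{m_i}$; write $x_t=(x_t^1,x_t^2)$, $u_t=(u_t^1,u_t^2)$. Types evolve as $x_{t+1}^i=A_t^ix_t^i+B_t^iu_t+w_t^i$ with $x_1^i\sim N(0,\Sigma_1^i)$, $w_t^i\sim N(0,Q^i)$, all independent, where $\Sigma_1^i,Q^i$ are positive semidefinite. At stage $t$ player $i$ knows $h_t^i=(u_{1:t-1},x_{1:t}^i)$ and may randomize. Her cost is $\sum_{t=1}^TR^i(x_t,u_t)$, $R^i(x,u)=u^\dagger T^iu+x^\dagger P^ix+2u^\dagger S^ix$, with $T^i,P^i$ symmetric; she minimizes its expectation. **PBE.** A strategy profile $\beta$ and a belief system $\mu$ (a measurable assignment, to each private history $h_t^i$, of a probability measure on complete histories $(u_{1:t-1},x_{1:t})$ under which $h_t^i$ is known) form a perfect Bayesian equilibrium if: 1. (Sequential rationality) for every $i$, $t$, $h_t^i$, the cost-to-go $\sum_{n=t}^TR^i(x_n,u_n)$ is integrable under $\mu$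 at $h_t^i$ and $\beta$, and its expectation is at most the one under $\mu$ at $h_t^i$ and $(\beta'^i,\beta^{-i})$, for every randomized history-dependent strategy $\beta'^i$ of player $i$ for which this expectation is well defined in $[-\infty,\infty]$. 2. (Consistency) the belief about $x^j_{1:t}$, $j\ne i$, depends on $u_{1:t-1}$ only; at $t=1$ it is the prior; after every $u_{1:t-1}$, on the equilibrium path or not, it is updated by Bayes' rule given $u^j_t$ played according to $\beta_t^j$ (a version of the conditional law), the update of the belief about $x^j_{1:t}$ depends on $u_t$ through $u_t^j$ only, and $x^j_{t+1}$ is then appended according to the transition law. **Construction.** For a pair $\Sigma=(\Sigma^1,\Sigma^2)$ of covariances and $L=(L^1,L^2)$ let $G^i=\Sigma^iL^{i\dagger}(L^i\Sigma^iL^{i\dagger})^{+}$ (Moore–Penrose pseudo-inverse), and let $\phi_s(\Sigma,L)$ be the pair with components $$A_t^i(I-G^iL^i)\Sigma^i(I-G^iL^i)^\dagger A_t^{i\dagger}+Q^i .$$ Write $B^i_t=[B^i_{1,t}\;B^i_{2,t}]$ for the parts acting on $u^1,u^2$. Put $e^i=(x_t^i,\hat x_t^i,\hat x_t^{-i})$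 and $y^i=(u_t^i,u_t^{-i},x_t^i,x_t^{-i},x_{t+1}^i,\hat x_{t+1}^i,\hat x_{t+1}^{-i})$. Let $D_t^{ui}u^i+[D_t^{ei}]_1x^i+[D_t^{ei}]_{23}(\hat x^i,\hat x^{-i})+C_t^i(m^i,m^{-i})$ be the vector with components, in the order of $y^i$, $$u^i,\quad \bar u:=L^{-i}\hat x^{-i}+m^{-i},\quad x^i,\quad \hat x^{-i},\quad A_t^ix^i+B_{i,t}^iu^i+B_{-i,t}^i\bar u,$$ $$A_t^i\hat x^i+B_{i,t}^iu^i+B^i_{-i,t}\bar u+A_t^iG^i(u^i-L^i\hat x^i-m^i),\quad A_t^{-i}\hat x^{-i}+B_{i,t}^{-i}u^i+B_{-i,t}^{-i}\bar u,$$ and let $D_t^{ei}=\big[[D_t^{ei}]_1\;[D_t^{ei}]_{23}\big]$. Let $\tilde L_t^i(\Sigma)$, $\tilde M_t^i(\Sigma)$ be matrix-valued functions, where $\tilde M_t^i$ acts on $\hat x=(\hat x^1,\hat x^2)$ and $\tilde M_t=(\tilde M_t^1;\tilde M_t^2)$. Set $V_{T+1}^i:=0$ and, for $t=T,\dots,1$,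 with all matrices taken at $L=\tilde L_t(\Sigma)$, $$\bar V_t^i(\Sigma)=\begin{bmatrix}T^i&S^i&0\\S^{i\dagger}&P^i&0\\0&0&V_{t+1}^i(\phi_s(\Sigma,\tilde L_t))\end{bmatrix},\qquad V_t^i(\Sigma)=F_t^{i\dagger}\bar V_t^iF_t^i,$$ $$F_t^i=\big[D_t^{ui}\tilde L_t^i\;\;D_t^{ui}\tilde M_t^i+C_t^i\tilde M_t\big]+D_t^{ei}$$ (vectors being ordered with the components of player $i$ first). Let $\Sigma_{t+1}=\phi_s(\Sigma_t,\tilde L_t(\Sigma_t))$, starting from the given $\Sigma_1$. Assume that for all $t=1,\dots,T$ and $i=1,2$, at $\Sigma=\Sigma_t$ (for instance, at all pairs of covariances), $D_t^{ui\dagger}\bar V_t^iD_t^{ui}$ is positive definite and $$D_t^{ui\dagger}\bar V_t^iD_t^{ui}\,\tilde L_t^i=-D_t^{ui\dagger}\bar V_t^i[D_t^{ei}]_1,$$ $$D_t^{ui\dagger}\bar V_t^iD_t^{ui}\,\tilde M_t^i=-D_t^{ui\dagger}\bar V_t^i[D_t^{ei}]_{23}-D_t^{ui\dagger}\bar V_t^iC_t^i\tilde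 M_t .$$ Writing $\tilde L_t,\tilde M_t,G_t$ for the values at $\Sigma_t$, define $\hat x_1=0$ and, for every $u_{1:t}$, $$\hat x_{t+1}^i=A_t^i\hat x_t^i+B_t^iu_t+A_t^iG_t^i\big(u_t^i-\tilde L_t^i\hat x_t^i-\tilde M_t^i\hat x_t\big).$$ Let $\beta^{*,i}_t$ be the deterministic strategy $u_t^i=\tilde L_t^ix_t^i+\tilde M_t^i\hat x_t$ and $\mu_t^{*,i}[u_{1:t-1}]=N(\hat x_t^i,\Sigma_t^i)$. **Theorem.** $(\beta^*,\mu^*)$ is a perfect Bayesian equilibrium of the game: there is a belief system $\mu$ under which, at every $h_t^i$, the belief of player $i$ about the current type $x_t^{j}$ of the other player $j=-i$ is $\mu_t^{*,j}[u_{1:t-1}]$, such that $(\beta^*,\mu)$ is a perfect Bayesian equilibrium. (The covariances $\Sigma_t$ of the beliefs depend on the strategies through $\tilde L_t$, so the equilibrium is a signaling one.) -/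

import Mathlib

open MeasureTheory ProbabilityTheory Matrix
open scoped ENNReal

noncomputable section

namespace LQG

/-! ### Moore–Penrose pseudo-inverse of a real matrix -/

section PseudoInverse

variable {a b : Type} [Fintype a] [Fintype b]

/-- `X` is the Moore–Penrose pseudo-inverse of `A` (the four Penrose conditions). -/
structure IsMoorePenrose (A : Matrix a b ℝ) (X : Matrix b a ℝ) : Prop where
  mul_mul_self : A * X * A = A
  self_mul_mul : X * A * X = X
  symm_left : (A * X)ᵀ = A * X
  symm_right : (X * A)ᵀ = X * A

theorem IsMoorePenrose.unique {A : Matrix a b ℝ} {X Y : Matrix b a ℝ}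
    (hX : IsMoorePenrose A X) (hY : IsMoorePenrose A Y) : X = Y := by
  have h1 : A * X = A * Y := by
    have : (A * Y * (A * X))ᵀ = (A * X)ᵀ := by
      rw [← Matrix.mul_assoc, hY.mul_mul_self]
    rw [Matrix.transpose_mul, hX.symm_left, hY.symm_left, ← Matrix.mul_assoc,
      hX.mul_mul_self] at this
    exact this.symm
  have h2 : X * A = Y * A := by
    have : (X * A * (Y * A))ᵀ = (X * A)ᵀ := by
      rw [Matrix.mul_assoc, ← Matrix.mul_assoc A Y A, hY.mul_mul_self]
    rw [Matrix.transpose_mul, hX.symm_right, hY.symm_right, Matrix.mul_assoc,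
      ← Matrix.mul_assoc A X A, hX.mul_mul_self] at this
    exact this.symm
  calc X = X * A * X := hX.self_mul_mul.symm
    _ = Y * A * X := by rw [h2]
    _ = Y * A * Y := by rw [Matrix.mul_assoc, h1, ← Matrix.mul_assoc]
    _ = Y := hY.self_mul_mul

theorem exists_isMoorePenrose [DecidableEq b] (A : Matrix a b ℝ) :
    ∃ X, IsMoorePenrose A X := by
  have hB : IsSelfAdjoint (Aᵀ * A) := by
    have := Matrix.isHermitian_conjTranspose_mul_self A
    rwa [Matrix.conjTranspose_eq_transpose_of_trivial] at this
  have hc : ∀ f : ℝ → ℝ, ContinuousOn f (spectrum ℝ (Aᵀ * A)) := fun f =>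
    (Matrix.finite_real_spectrum).continuousOn f
  set B := Aᵀ * A with hBdef
  set Y := cfc (fun x : ℝ => x⁻¹) B with hY
  have hid : cfc (fun x : ℝ => x) B = B := cfc_id' ℝ B
  have hBY : B * Y = cfc (fun x : ℝ => x * x⁻¹) B := by
    conv_lhs => rw [← hid]
    rw [hY, hid, cfc_mul (fun x : ℝ => x) (fun x : ℝ => x⁻¹) B (hc _) (hc _), hid]
  have hYB : Y * B = cfc (fun x : ℝ => x * x⁻¹) B := by
    rw [← hBY, hY]
    have := (cfc_commute_cfc (fun x : ℝ => x⁻¹) (fun x : ℝ => x) B).eq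
    rwa [hid] at this
  have hBYB : B * Y * B = B := by
    rw [hBY]
    nth_rewrite 2 [← hid]
    rw [← cfc_mul _ _ B (hc _) (hc _)]
    conv_rhs => rw [← hid]
    congr 1; funext x
    by_cases h : x = 0 <;> simp [h]
  have hYBY : Y * B * Y = Y := by
    rw [hYB, hY, ← cfc_mul _ _ B (hc _) (hc _)]
    congr 1; funext x
    by_cases h : x = 0 <;> simp [h]
  have hYs : Yᵀ = Y := by
    have : IsSelfAdjoint Y := cfc_predicate _ _
    rw [← Matrix.conjTranspose_eq_transpose_of_trivial]
    exact this
  have hBs : Bᵀ = B := by rw [hBdef, Matrix.transpose_mul, Matrix.transpose_transpose]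
  have hYBs : (Y * B)ᵀ = Y * B := by
    rw [Matrix.transpose_mul, hYs, hBs, hBY, hYB]
  have hA : A * Y * Aᵀ * A = A := by
    have h0 : Aᵀ * (A * (Y * B - 1)) = 0 := by
      rw [← Matrix.mul_assoc, Matrix.mul_sub, Matrix.mul_one, ← hBdef, ← Matrix.mul_assoc, hBYB,
        sub_self]
    have h1 : A * (Y * B - 1) = 0 := by
      have h2 : (A * (Y * B - 1))ᴴ * (A * (Y * B - 1)) = 0 := by
        rw [Matrix.conjTranspose_eq_transpose_of_trivial, Matrix.transpose_mul,
          Matrix.mul_assoc, h0, Matrix.mul_zero]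
      exact Matrix.conjTranspose_mul_self_eq_zero.mp h2
    rw [Matrix.mul_sub, Matrix.mul_one, sub_eq_zero] at h1
    rw [Matrix.mul_assoc, Matrix.mul_assoc, ← hBdef]
    exact h1
  refine ⟨Y * Aᵀ, ?_, ?_, ?_, ?_⟩
  · rw [← Matrix.mul_assoc, hA]
  · rw [Matrix.mul_assoc Y, ← hBdef, ← Matrix.mul_assoc, hYBY]
  · rw [Matrix.transpose_mul, Matrix.transpose_mul, Matrix.transpose_transpose, hYs,
      Matrix.mul_assoc]
  · rw [Matrix.mul_assoc, ← hBdef, hYBs]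

/-- The Moore–Penrose pseudo-inverse. -/
def pinv [DecidableEq b] (A : Matrix a b ℝ) : Matrix b a ℝ :=
  (exists_isMoorePenrose A).choose

theorem pinv_spec [DecidableEq b] (A : Matrix a b ℝ) : IsMoorePenrose A (pinv A) :=
  (exists_isMoorePenrose A).choose_spec

end PseudoInverse

/-! ### Players, histories, the game -/

/-- The player other than `i`; the two players are the elements of `Fin 2`. -/
def opp (i : Fin 2) : Fin 2 := 1 - i

/-- A pair of vectors, one for each player, with the dimension of player `j`'s vector `d j`. -/
abbrev Joint (d : Fin 2 → ℕ) : Type := ∀ j, Fin (d j) → ℝ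

/-- Stages are numbered `0, 1, …, T - 1`.  A public history at stage `t` is the list of the action
profiles at stages `0, …, t - 1`. -/
abbrev PubHist (m : Fin 2 → ℕ) (t : ℕ) : Type := Fin t → Joint m

/-- The types of player `j` at stages `0, …, t`. -/
abbrev TypeHist (n : Fin 2 → ℕ) (j : Fin 2) (t : ℕ) : Type := Fin (t + 1) → (Fin (n j) → ℝ)

/-- What player `i` has observed at stage `t`: past action profiles, own past and present types. -/
abbrev PrivHist (n m : Fin 2 → ℕ) (i : Fin 2) (t : ℕ) : Type := PubHist m t × TypeHist n i t

/-- A complete history at stage `t`: past action profiles, past and present type profiles. -/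
abbrev Hist (n m : Fin 2 → ℕ) (t : ℕ) : Type := PubHist m t × (Fin (t + 1) → Joint n)

/-- The type history of player `j` in a complete history. -/
def Hist.types {n m : Fin 2 → ℕ} {t : ℕ} (j : Fin 2) (h : Hist n m t) : TypeHist n j t :=
  fun k => h.2 k j

/-- The private history of player `i` in a complete history. -/
def Hist.priv {n m : Fin 2 → ℕ} {t : ℕ} (i : Fin 2) (h : Hist n m t) : PrivHist n m i t :=
  (h.1, h.types i)

/-- Stacks the two vectors of a pair into one vector. -/
def stack {d : Fin 2 → ℕ} (v : Joint d) : (Σ j, Fin (d j)) → ℝ := fun p => v p.1 p.2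

/-- The (possibly degenerate) Gaussian law `N(c, S)` on `ℝ^d`. -/
def gauss {d : ℕ} (c : Fin d → ℝ) (S : Matrix (Fin d) (Fin d) ℝ) : Measure (Fin d → ℝ) :=
  (multivariateGaussian (WithLp.toLp 2 c) S).map WithLp.ofLp

/-- The data of the two-player dynamic LQG game; `n j` and `m j` are the dimensions of the types and
the actions of player `j`. -/
structure Game (n m : Fin 2 → ℕ) where
  /-- number of stages -/
  horizon : ℕ
  A : ℕ → ∀ i, Matrix (Fin (n i)) (Fin (n i)) ℝ
  B : ℕ → ∀ i, Matrix (Fin (n i)) (Σ j, Fin (m j)) ℝ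
  /-- noise covariances -/
  Q : ∀ i, Matrix (Fin (n i)) (Fin (n i)) ℝ
  /-- covariances of the initial types -/
  S₁ : ∀ i, Matrix (Fin (n i)) (Fin (n i)) ℝ
  /-- cost matrices `T^i`, `P^i`, `S^i` -/
  costT : Fin 2 → Matrix (Σ j, Fin (m j)) (Σ j, Fin (m j)) ℝ
  costP : Fin 2 → Matrix (Σ j, Fin (n j)) (Σ j, Fin (n j)) ℝ
  costS : Fin 2 → Matrix (Σ j, Fin (m j)) (Σ j, Fin (n j)) ℝ
  Q_posSemidef : ∀ i, (Q i).PosSemidef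
  S₁_posSemidef : ∀ i, (S₁ i).PosSemidef
  costT_symm : ∀ i, (costT i).IsSymm
  costP_symm : ∀ i, (costP i).IsSymm

/-- A behavioural strategy of player `i`. -/
abbrev Strategy (n m : Fin 2 → ℕ) (i : Fin 2) : Type :=
  ∀ t, Kernel (PrivHist n m i t) (Fin (m i) → ℝ)

abbrev Profile (n m : Fin 2 → ℕ) : Type := ∀ i, Strategy n m i

/-- A belief system: at each private history of each player, a measure on complete histories. -/
abbrev BeliefSystem (n m : Fin 2 → ℕ) : Type :=
  ∀ (i : Fin 2) (t : ℕ), Kernel (PrivHist n m i t) (Hist n m t)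

/-- The law of the action profile at stage `t`, the two players randomizing independently, each on
the basis of the own private history. -/
def actionKernel {n m : Fin 2 → ℕ} (g : Profile n m) (t : ℕ) : Kernel (Hist n m t) (Joint m) :=
  (((g 0 t) ∘ₖ (Kernel.id.map (Hist.priv 0))) ×ₖ
    ((g 1 t) ∘ₖ (Kernel.id.map (Hist.priv 1)))).map
      (MeasurableEquiv.piFinTwo fun j => Fin (m j) → ℝ).symm

namespace Game

variable {n m : Fin 2 → ℕ} (G : Game n m)

/-- The instantaneous cost `R^i(x, u) = uᵀ T^i u + xᵀ P^i x + 2 uᵀ S^i x`. -/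
def stageCost (i : Fin 2) (x : Joint n) (u : Joint m) : ℝ :=
  stack u ⬝ᵥ (G.costT i *ᵥ stack u) + stack x ⬝ᵥ (G.costP i *ᵥ stack x) +
    2 * (stack u ⬝ᵥ (G.costS i *ᵥ stack x))

/-- The next type of player `i` as a function of the type, the action profile and the noise. -/
def nextType (t : ℕ) (i : Fin 2) (x : Fin (n i) → ℝ) (u : Joint m) (w : Fin (n i) → ℝ) :
    Fin (n i) → ℝ :=
  G.A t i *ᵥ x + G.B t i *ᵥ stack u + w

/-- One stage of play under the profile `g`. -/
def step (g : Profile n m) (t : ℕ) : Kernel (Hist n m t) (Hist n m (t + 1)) :=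
  ((Kernel.id ×ₖ actionKernel g t) ×ₖ
    Kernel.const (Hist n m t) (Measure.pi fun j => gauss (0 : Fin (n j) → ℝ) (G.Q j))).map
      fun p : (Hist n m t × Joint m) × Joint n =>
        (Fin.snoc (α := fun _ => Joint m) p.1.1.1 p.1.2,
          Fin.snoc (α := fun _ => Joint n) p.1.1.2
            fun j => G.nextType t j (p.1.1.2 (Fin.last t) j) p.1.2 (p.2 j))

/-- The law of the complete history at stage `t + k`, given the one at stage `t`, when the players
follow `g` at stages `t, …, t + k - 1`. -/
def evolve (g : Profile n m) (t : ℕ) : (k : ℕ) → Kernel (Hist n m t) (Hist n m (t + k))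
  | 0 => Kernel.id
  | k + 1 => G.step g (t + k) ∘ₖ evolve g t k

/-- The sum of the costs of player `i` at stages `t, …, s - 1` along a complete history. -/
def costFrom (i : Fin 2) (t : ℕ) {s : ℕ} (h : Hist n m s) : ℝ :=
  ∑ k : Fin s, if t ≤ (k : ℕ) then G.stageCost i (h.2 k.castSucc) (h.1 k) else 0

end Game

/-! ### Perfect Bayesian equilibrium -/

/-- The expectation of `f` is well defined in `[-∞, ∞]`. -/
def HasExpectation {Ω : Type} [MeasurableSpace Ω] (P : Measure Ω) (f : Ω → ℝ) : Prop :=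
  ∫⁻ ω, ENNReal.ofReal (f ω) ∂P ≠ ⊤ ∨ ∫⁻ ω, ENNReal.ofReal (-f ω) ∂P ≠ ⊤

/-- The expectation of `f`, with values in `[-∞, ∞]`. -/
def expectation {Ω : Type} [MeasurableSpace Ω] (P : Measure Ω) (f : Ω → ℝ) : EReal :=
  ((∫⁻ ω, ENNReal.ofReal (f ω) ∂P : ℝ≥0∞) : EReal) -
    ((∫⁻ ω, ENNReal.ofReal (-f ω) ∂P : ℝ≥0∞) : EReal)

namespace Game

variable {n m : Fin 2 → ℕ} (G : Game n m)

/-- Sequential rationality: at every private history of every player, the strategy of that player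
minimizes the expected cost-to-go over all (randomized, history-dependent) strategies.  Under the
profile itself the cost-to-go is integrable; a deviation has to have a well-defined expected
cost-to-go, which may be infinite. -/
def IsSequentiallyRational (β : Profile n m) (μ : BeliefSystem n m) : Prop :=
  ∀ (i : Fin 2) (t k : ℕ), 0 < k → t + k = G.horizon → ∀ h : PrivHist n m i t,
    Integrable (G.costFrom i t) ((μ i t h).bind (G.evolve β t k)) ∧
    ∀ g : Strategy n m i, (∀ s, IsMarkovKernel (g s)) →
      HasExpectation ((μ i t h).bind (G.evolve (Function.update β i g) t k)) (G.costFrom i t) →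
      expectation ((μ i t h).bind (G.evolve β t k)) (G.costFrom i t) ≤
        expectation ((μ i t h).bind (G.evolve (Function.update β i g) t k)) (G.costFrom i t)

/-- Consistency of the beliefs.  Each player knows the own private history.  The belief about the
types of player `j` depends on the public history only (`ν`); it starts from the prior; at every
public history, on the equilibrium path or not, it is updated by Bayes' rule given the action of `j`
(`post` is a version of the conditional law of the type history of `j` given that action); the update
depends on the action of the other player through the transition law only. -/
structure IsConsistent (β : Profile n m) (μ : BeliefSystem n m) : Prop where
  markov : ∀ i t, IsMarkovKernel (μ i t)
  known : ∀ (i : Fin 2) (t : ℕ), t < G.horizon → ∀ h : PrivHist n m i t,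
    ∀ᵐ h' ∂(μ i t h), Hist.priv i h' = h
  bayes : ∃ (ν : ∀ (j : Fin 2) (t : ℕ), Kernel (PubHist m t) (TypeHist n j t))
      (post : ∀ (j : Fin 2) (t : ℕ), Kernel (PubHist m t × (Fin (m j) → ℝ)) (TypeHist n j t)),
    (∀ j t, IsMarkovKernel (ν j t)) ∧ (∀ j t, IsMarkovKernel (post j t)) ∧
    (∀ i j, i ≠ j → ∀ t, t < G.horizon → ∀ h : PrivHist n m i t,
      (μ i t h).map (Hist.types j) = ν j t h.1) ∧
    (∀ j u, ν j 0 u = (gauss (0 : Fin (n j) → ℝ) (G.S₁ j)).map fun x _ => x) ∧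
    (∀ j t, t + 1 < G.horizon → ∀ u : PubHist m t,
      ((ν j t u) ⊗ₘ ((β j t).sectR u)).map Prod.swap =
        ((ν j t u).bind ((β j t).sectR u)) ⊗ₘ ((post j t).sectR u)) ∧
    (∀ j t, t + 1 < G.horizon → ∀ (u : PubHist m t) (a : Joint m),
      ν j (t + 1) (Fin.snoc (α := fun _ => Joint m) u a) =
        ((post j t (u, a j)).prod (gauss (0 : Fin (n j) → ℝ) (G.Q j))).map
          fun p => Fin.snoc (α := fun _ => Fin (n j) → ℝ) p.1
            (G.nextType t j (p.1 (Fin.last t)) a p.2))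

/-- Perfect Bayesian equilibrium. -/
structure IsPBE (β : Profile n m) (μ : BeliefSystem n m) : Prop where
  markov : ∀ i t, IsMarkovKernel (β i t)
  rational : G.IsSequentiallyRational β μ
  consistent : G.IsConsistent β μ

/-! ### The belief update for linear strategies -/

end Game

/-- A pair of covariance matrices. -/
abbrev Cov (n : Fin 2 → ℕ) : Type := ∀ j, Matrix (Fin (n j)) (Fin (n j)) ℝ

/-- A pair of feedback matrices `L^i`. -/
abbrev Feedback (n m : Fin 2 → ℕ) : Type := ∀ i, Matrix (Fin (m i)) (Fin (n i)) ℝ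

/-- The gain `G^i = Σ^i L^iᵀ (L^i Σ^i L^iᵀ)⁺`. -/
def gain {n m : Fin 2 → ℕ} (S : Cov n) (L : Feedback n m) (i : Fin 2) :
    Matrix (Fin (n i)) (Fin (m i)) ℝ :=
  S i * (L i)ᵀ * pinv (L i * S i * (L i)ᵀ)

namespace Game

variable {n m : Fin 2 → ℕ} (G : Game n m)

/-- The update `φ_s` of the covariances. -/
def covUpdate (t : ℕ) (S : Cov n) (L : Feedback n m) : Cov n := fun i =>
  G.A t i * (1 - gain S L i * L i) * S i * (1 - gain S L i * L i)ᵀ * (G.A t i)ᵀ + G.Q i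

/-- The update `φ_x` of the means, for the strategies `u^i = L^i x^i + c^i`. -/
def meanUpdate (t : ℕ) (xh : Joint n) (S : Cov n) (L : Feedback n m) (c u : Joint m) : Joint n :=
  fun i => G.A t i *ᵥ xh i + G.B t i *ᵥ stack u +
    (G.A t i * gain S L i) *ᵥ (u i - L i *ᵥ xh i - c i)

end Game

/-! ### Backward recursion -/

/-- An equilibrium generating function: `L t S i` and `M t S i` are the matrices of the strategy
`u^i = L x^i + M x̂` at stage `t`, when the common beliefs are Gaussian with covariances `S` and
stacked means `x̂`. -/
structure GenFun (n m : Fin 2 → ℕ) where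
  L : ℕ → Cov n → Feedback n m
  M : ℕ → Cov n → ∀ i, Matrix (Fin (m i)) (Σ j, Fin (n j)) ℝ

/-- Enumerates the coordinates of a pair of vectors, those of player `i` first. -/
def selfFirst (d : Fin 2 → ℕ) (i : Fin 2) : Fin (d i) ⊕ Fin (d (opp i)) → Σ j, Fin (d j) :=
  Sum.elim (fun a => ⟨i, a⟩) (fun a => ⟨opp i, a⟩)

/-- Coordinates of `e^i = (x^i, x̂^i, x̂^{-i})`. -/
abbrev EIdx (n : Fin 2 → ℕ) (i : Fin 2) : Type := Fin (n i) ⊕ (Fin (n i) ⊕ Fin (n (opp i)))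

/-- Coordinates of `y^i = (u^i, u^{-i}, x^i, x^{-i}, x_+^i, x̂_+^i, x̂_+^{-i})`, where `+` marks the
next stage. -/
abbrev YIdx (n m : Fin 2 → ℕ) (i : Fin 2) : Type :=
  ((Fin (m i) ⊕ Fin (m (opp i))) ⊕ (Fin (n i) ⊕ Fin (n (opp i)))) ⊕ EIdx n i

/-- A matrix given by its seven block rows, in the order of `YIdx`. -/
def yRows {n m : Fin 2 → ℕ} {i : Fin 2} {c : Type}
    (r₁ : Matrix (Fin (m i)) c ℝ) (r₂ : Matrix (Fin (m (opp i))) c ℝ)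
    (r₃ : Matrix (Fin (n i)) c ℝ) (r₄ : Matrix (Fin (n (opp i))) c ℝ)
    (r₅ : Matrix (Fin (n i)) c ℝ) (r₆ : Matrix (Fin (n i)) c ℝ)
    (r₇ : Matrix (Fin (n (opp i))) c ℝ) : Matrix (YIdx n m i) c ℝ :=
  fromRows (fromRows (fromRows r₁ r₂) (fromRows r₃ r₄)) (fromRows r₅ (fromRows r₆ r₇))

namespace Game

variable {n m : Fin 2 → ℕ} (G : Game n m)

/-- The part of `B_t^i` that multiplies `u^j`. -/
def Bblock (t : ℕ) (i j : Fin 2) : Matrix (Fin (n i)) (Fin (m j)) ℝ :=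
  (G.B t i).submatrix id fun a => ⟨j, a⟩

/-- `D^{ui}`: the dependence on `u^i` of the conditional mean of `y^i`. -/
def Du (t : ℕ) (S : Cov n) (L : Feedback n m) (i : Fin 2) : Matrix (YIdx n m i) (Fin (m i)) ℝ :=
  yRows 1 0 0 0 (G.Bblock t i i) (G.A t i * gain S L i + G.Bblock t i i) (G.Bblock t (opp i) i)

/-- `[D^{ei}]_1`: the dependence on `x^i`. -/
def De₁ (t : ℕ) (i : Fin 2) : Matrix (YIdx n m i) (Fin (n i)) ℝ :=
  yRows 0 0 1 0 (G.A t i) 0 0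

/-- `[D^{ei}]_{23}`: the dependence on `(x̂^i, x̂^{-i})`. -/
def De₂₃ (t : ℕ) (S : Cov n) (L : Feedback n m) (i : Fin 2) :
    Matrix (YIdx n m i) (Fin (n i) ⊕ Fin (n (opp i))) ℝ :=
  yRows
    0
    (fromCols 0 (L (opp i)))
    0
    (fromCols 0 1)
    (fromCols 0 (G.Bblock t i (opp i) * L (opp i)))
    (fromCols (G.A t i * (1 - gain S L i * L i)) (G.Bblock t i (opp i) * L (opp i)))
    (fromCols 0 (G.A t (opp i) + G.Bblock t (opp i) (opp i) * L (opp i)))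

/-- `C^i`: the dependence on `(m^i, m^{-i})`, the constant terms of the prescribed strategies. -/
def Cmat (t : ℕ) (S : Cov n) (L : Feedback n m) (i : Fin 2) :
    Matrix (YIdx n m i) (Fin (m i) ⊕ Fin (m (opp i))) ℝ :=
  yRows
    0
    (fromCols 0 1)
    0
    0
    (fromCols 0 (G.Bblock t i (opp i)))
    (fromCols (-(G.A t i * gain S L i)) (G.Bblock t i (opp i)))
    (fromCols 0 (G.Bblock t (opp i) (opp i)))

/-- `V̄^i`, the block-diagonal matrix with blocks `[T^i, S^i; S^iᵀ, P^i]` and `V`. -/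
def Vbar (i : Fin 2) (V : Matrix (EIdx n i) (EIdx n i) ℝ) :
    Matrix (YIdx n m i) (YIdx n m i) ℝ :=
  fromBlocks
    (fromBlocks
      ((G.costT i).submatrix (selfFirst m i) (selfFirst m i))
      ((G.costS i).submatrix (selfFirst m i) (selfFirst n i))
      ((G.costS i)ᵀ.submatrix (selfFirst n i) (selfFirst m i))
      ((G.costP i).submatrix (selfFirst n i) (selfFirst n i)))
    0 0 V

end Game

namespace GenFun

variable {n m : Fin 2 → ℕ} (θ : GenFun n m)

/-- `M^i`, acting on `(x̂^i, x̂^{-i})`. -/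
def Mself (t : ℕ) (S : Cov n) (i : Fin 2) :
    Matrix (Fin (m i)) (Fin (n i) ⊕ Fin (n (opp i))) ℝ :=
  (θ.M t S i).submatrix id (selfFirst n i)

/-- `M^i` on top of `M^{-i}`, acting on `(x̂^i, x̂^{-i})`. -/
def Mboth (t : ℕ) (S : Cov n) (i : Fin 2) :
    Matrix (Fin (m i) ⊕ Fin (m (opp i))) (Fin (n i) ⊕ Fin (n (opp i))) ℝ :=
  fromRows ((θ.M t S i).submatrix id (selfFirst n i))
    ((θ.M t S (opp i)).submatrix id (selfFirst n i))

end GenFun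

namespace Game

variable {n m : Fin 2 → ℕ} (G : Game n m) (θ : GenFun n m)

/-- `F^i = [D^{ui} L^i, D^{ui} M^i + C^i M] + D^{ei}`. -/
def Fmat (t : ℕ) (S : Cov n) (i : Fin 2) : Matrix (YIdx n m i) (EIdx n i) ℝ :=
  fromCols
    (G.Du t S (θ.L t S) i * θ.L t S i)
    (G.Du t S (θ.L t S) i * θ.Mself t S i + G.Cmat t S (θ.L t S) i * θ.Mboth t S i) +
  fromCols (G.De₁ t i) (G.De₂₃ t S (θ.L t S) i)

/-- The matrix of the value function of player `i` at stage `t` with `k` stages left to play,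
as a function of the covariances. -/
def valueAux : (k t : ℕ) → Cov n → ∀ i, Matrix (EIdx n i) (EIdx n i) ℝ
  | 0, _, _, _ => 0
  | k + 1, t, S, i =>
    (G.Fmat θ t S i)ᵀ *
      G.Vbar i (valueAux k (t + 1) (G.covUpdate t S (θ.L t S)) i) * G.Fmat θ t S i

/-- `V_t^i(S)`. -/
def value (t : ℕ) (S : Cov n) (i : Fin 2) : Matrix (EIdx n i) (EIdx n i) ℝ :=
  G.valueAux θ (G.horizon - t) t S i

/-- `V̄_t^i(S, L)` at `L = θ.L t S`. -/
def valueBar (t : ℕ) (S : Cov n) (i : Fin 2) : Matrix (YIdx n m i) (YIdx n m i) ℝ :=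
  G.Vbar i (G.value θ (t + 1) (G.covUpdate t S (θ.L t S)) i)

/-- The step of the backward recursion at stage `t` and covariances `S` is solved by `θ`: for each
player the Hessian is positive definite, and `L` and `M` solve the matrix fixed-point equation and
the linear equation, respectively. -/
structure Solves (t : ℕ) (S : Cov n) : Prop where
  posDef : ∀ i,
    ((G.Du t S (θ.L t S) i)ᵀ * G.valueBar θ t S i * G.Du t S (θ.L t S) i).PosDef
  eq_L : ∀ i,
    ((G.Du t S (θ.L t S) i)ᵀ * G.valueBar θ t S i * G.Du t S (θ.L t S) i) * θ.L t S i =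
      -((G.Du t S (θ.L t S) i)ᵀ * G.valueBar θ t S i * G.De₁ t i)
  eq_M : ∀ i,
    ((G.Du t S (θ.L t S) i)ᵀ * G.valueBar θ t S i * G.Du t S (θ.L t S) i) * θ.Mself t S i =
      -((G.Du t S (θ.L t S) i)ᵀ * G.valueBar θ t S i * G.De₂₃ t S (θ.L t S) i) -
        (G.Du t S (θ.L t S) i)ᵀ * G.valueBar θ t S i * G.Cmat t S (θ.L t S) i * θ.Mboth t S i

/-! ### Forward recursion -/

/-- The covariances `Σ_t` of the common beliefs. -/
def cov : ℕ → Cov n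
  | 0 => G.S₁
  | t + 1 => G.covUpdate t (cov t) (θ.L t (cov t))

/-- The means `x̂_t` of the common beliefs, as functions of the public history. -/
def mean : (t : ℕ) → PubHist m t → Joint n
  | 0, _ => 0
  | t + 1, u =>
    G.meanUpdate t (mean t fun k => u k.castSucc) (G.cov θ t) (θ.L t (G.cov θ t))
      (fun i => θ.M t (G.cov θ t) i *ᵥ stack (mean t fun k => u k.castSucc)) (u (Fin.last t))

/-- The action `L^i x_t^i + M^i x̂_t` prescribed at a private history. -/
def action (i : Fin 2) (t : ℕ) (h : PrivHist n m i t) : Fin (m i) → ℝ :=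
  θ.L t (G.cov θ t) i *ᵥ h.2 (Fin.last t) + θ.M t (G.cov θ t) i *ᵥ stack (G.mean θ t h.1)

theorem continuous_mean (t : ℕ) : Continuous (G.mean θ t) := by
  induction t with
  | zero => exact continuous_const
  | succ t ih =>
    have h : Continuous fun u : PubHist m (t + 1) => G.mean θ t fun k => u k.castSucc :=
      ih.comp (by fun_prop)
    have hs : ∀ {d : Fin 2 → ℕ}, Continuous (stack (d := d)) := fun {d} => by
      unfold stack; fun_prop
    refine continuous_pi fun i => ?_
    have hi : Continuous fun u : PubHist m (t + 1) => G.mean θ t (fun k => u k.castSucc) i :=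
      (continuous_apply i).comp h
    have hl : Continuous fun u : PubHist m (t + 1) => u (Fin.last t) := continuous_apply _
    refine Continuous.add (Continuous.add ?_ ?_) ?_
    · exact Continuous.matrix_mulVec continuous_const hi
    · exact Continuous.matrix_mulVec continuous_const (hs.comp hl)
    · refine Continuous.matrix_mulVec continuous_const (Continuous.sub (Continuous.sub ?_ ?_) ?_)
      · exact (continuous_apply i).comp hl
      · exact Continuous.matrix_mulVec continuous_const hi
      · exact Continuous.matrix_mulVec continuous_const (hs.comp h)

theorem measurable_action (i : Fin 2) (t : ℕ) : Measurable (G.action θ i t) := by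
  have hs : Continuous (stack (d := n)) := by unfold stack; fun_prop
  have h : Continuous fun h : PrivHist n m i t => h.2 (Fin.last t) := by fun_prop
  exact (Continuous.add (Continuous.matrix_mulVec continuous_const h)
    (Continuous.matrix_mulVec continuous_const
      (hs.comp ((G.continuous_mean θ t).comp continuous_fst)))).measurable

/-- The strategy profile `β*` of the forward recursion. -/
def betaStar : Profile n m := fun i t =>
  Kernel.deterministic (G.action θ i t) (G.measurable_action θ i t)

/-- The common belief `μ*` of the forward recursion about the current type of player `j`. -/
def muStar (j : Fin 2) (t : ℕ) (u : PubHist m t) : Measure (Fin (n j) → ℝ) :=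
  gauss (G.mean θ t u j) (G.cov θ t j)

end Game

end LQG

end

/-! Beliefs. When player `j` follows the prescribed strategy, the common belief about the type
history of `j` is a mean computed from the public history plus a centered Gaussian vector whose law
does not depend on past actions (`noiseLaw`). Up to a known vector, the action of `j` reveals `L z`,
with `z` the last entry of that Gaussian vector. Regressing the history on `L z` with the
pseudo-inverse leaves a residual uncorrelated with `L z`, hence, by joint Gaussianity, independent
of it (`indepFun_resid`). The posterior is therefore a shifted mean plus a copy of the residual
(`lintegral_bayes`). This formula makes sense after every action, probable or not, and is the
version of the conditional law used for consistency. At the last entry it reduces to the recursions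
for `mean` and `cov` (`histMean_last`, `noiseLaw_map_last`). The covariances are deterministic, so
even after deviations the backward recursion matters at `Σ_t` only.

Optimality of one stage. The belief about the other player depends on the public history only, so
after one stage the law of the complete history is a mixture of the beliefs at the next private
histories (`lintegral_playLaw_eq_beliefs`). The vector `y^i` is affine in the own action, up to a
centered noise that the action does not influence (`yVec_eq`); the expected quadratic cost is thus
the quadratic form at the mean plus a constant (`integral_roundCost_add`). The equations for `L` and
`M` say that the gradient in the own action vanishes at the prescribed action, and the Hessian
condition makes this a minimum (`valueFun_le_actionValue`).

Optimality over all stages. The cost of a deviation may be non-integrable after some private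
histories, so the Bellman inequality cannot be iterated with ordinary integrals. `LowerBound`
compares positive and negative parts in `[0, ∞]`, is vacuous when the positive part has infinite
integral, and is stable under mixtures and under adding integrable functions. The induction
`lowerBound_evolve` carries a factor `σ`: with `σ = 1` it bounds deviations from below, with `σ =
-1` it bounds the cost of the prescribed strategy from above. Integrability of the latter follows
from the same induction in an auxiliary game with cost `-c |(x, u)|²`, because the recursion `V = Fᵀ
V̄ F` evaluates the prescribed strategies whatever the costs are. -/

noncomputable section

namespace LQG

set_option linter.unusedSectionVars false

/-! ### Covariance matrices of square-integrable random vectors -/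

section CovarianceMatrix

variable {Ω : Type} [MeasurableSpace Ω] {a b c : Type} [Fintype a] [Fintype b] [Fintype c]

/-- All coordinates of the random vector are square-integrable. -/
def SqIntegrable (X : Ω → a → ℝ) (P : Measure Ω) : Prop := ∀ i, MemLp (fun ω => X ω i) 2 P

/-- The cross-covariance matrix of two random vectors. -/
def covMat (X : Ω → a → ℝ) (Y : Ω → b → ℝ) (P : Measure Ω) : Matrix a b ℝ :=
  Matrix.of fun i j => cov[fun ω => X ω i, fun ω => Y ω j; P]

variable {P : Measure Ω} [IsProbabilityMeasure P] {X X' : Ω → a → ℝ} {Y : Ω → b → ℝ}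

theorem SqIntegrable.mulVec (hX : SqIntegrable X P) (M : Matrix b a ℝ) :
    SqIntegrable (fun ω => M *ᵥ X ω) P := fun i => by
  simp only [Matrix.mulVec, dotProduct]
  exact memLp_finsetSum _ fun j _ => (hX j).const_mul _

theorem SqIntegrable.add (hX : SqIntegrable X P) (hX' : SqIntegrable X' P) :
    SqIntegrable (fun ω => X ω + X' ω) P := fun i => (hX i).add (hX' i)

theorem covMat_transpose : (covMat X Y P)ᵀ = covMat Y X P := by
  ext i j; exact covariance_comm _ _

theorem covMat_mulVec_left (hX : SqIntegrable X P) (hY : SqIntegrable Y P) (M : Matrix c a ℝ) :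
    covMat (fun ω => M *ᵥ X ω) Y P = M * covMat X Y P := by
  ext i j
  simp only [covMat, Matrix.mulVec, dotProduct, Matrix.of_apply, Matrix.mul_apply]
  rw [covariance_fun_sum_left (fun k => (hX k).const_mul _) (hY j)]
  simp only [covariance_const_mul_left]

theorem covMat_mulVec_right (hX : SqIntegrable X P) (hY : SqIntegrable Y P) (M : Matrix c b ℝ) :
    covMat X (fun ω => M *ᵥ Y ω) P = covMat X Y P * Mᵀ := by
  rw [← covMat_transpose, covMat_mulVec_left hY hX, Matrix.transpose_mul, covMat_transpose]

theorem covMat_add_left (hX : SqIntegrable X P) (hX' : SqIntegrable X' P)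
    (hY : SqIntegrable Y P) :
    covMat (fun ω => X ω + X' ω) Y P = covMat X Y P + covMat X' Y P := by
  ext i j; exact covariance_add_left (hX i) (hX' i) (hY j)

theorem covMat_sub_left (hX : SqIntegrable X P) (hX' : SqIntegrable X' P)
    (hY : SqIntegrable Y P) :
    covMat (fun ω => X ω - X' ω) Y P = covMat X Y P - covMat X' Y P := by
  ext i j; exact covariance_sub_left (hX i) (hX' i) (hY j)

theorem covMat_add_right (hY : SqIntegrable Y P) (hX : SqIntegrable X P)
    (hX' : SqIntegrable X' P) :
    covMat Y (fun ω => X ω + X' ω) P = covMat Y X P + covMat Y X' P := by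
  ext i j; exact covariance_add_right (hY i) (hX j) (hX' j)

theorem covMat_eq_zero_of_indepFun (hX : SqIntegrable X P) (hY : SqIntegrable Y P)
    (h : IndepFun X Y P) : covMat X Y P = 0 := by
  ext i j
  exact (h.comp (measurable_pi_apply i) (measurable_pi_apply j)).covariance_eq_zero (hX i) (hY j)

theorem covMat_map {Ω' : Type} [MeasurableSpace Ω'] {f : Ω' → Ω} {P' : Measure Ω'}
    (hf : Measurable f) (hX : Measurable X) (hY : Measurable Y) :
    covMat X Y (P'.map f) = covMat (fun ω => X (f ω)) (fun ω => Y (f ω)) P' := by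
  ext i j
  exact covariance_map (by fun_prop) (by fun_prop) hf.aemeasurable

/-- The cross-covariance with `Y` vanishes on the kernel of the covariance of `Y`. -/
theorem covMat_mul_pinv_mul [DecidableEq b] (hX : SqIntegrable X P) (hY : SqIntegrable Y P) :
    covMat X Y P * pinv (covMat Y Y P) * covMat Y Y P = covMat X Y P := by
  set V := covMat Y Y P with hV
  have hp := pinv_spec V
  have key : ∀ N : Matrix b b ℝ, V * N = 0 → covMat X Y P * N = 0 := by
    intro N hN
    have hZ : SqIntegrable (fun ω => Nᵀ *ᵥ Y ω) P := hY.mulVec _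
    have h0 : covMat (fun ω => Nᵀ *ᵥ Y ω) (fun ω => Nᵀ *ᵥ Y ω) P = 0 := by
      rw [covMat_mulVec_right hZ hY, covMat_mulVec_left hY hY, Matrix.transpose_transpose,
        Matrix.mul_assoc, ← hV, hN, Matrix.mul_zero]
    have h1 : covMat X (fun ω => Nᵀ *ᵥ Y ω) P = 0 := by
      ext i j
      -- `Nᵀ Y` has zero variance, so it is almost surely constant and uncorrelated with every
      -- variable.
      have hv : Var[fun ω => (Nᵀ *ᵥ Y ω) j; P] = 0 := by
        rw [← covariance_self (hZ j).aemeasurable]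
        exact congrFun (congrFun h0 j) j
      have hc := ae_eq_integral_of_variance_eq_zero (hZ j) hv
      simp only [covMat, Matrix.of_apply, Matrix.zero_apply, covariance]
      refine integral_eq_zero_of_ae ?_
      filter_upwards [hc] with ω hω
      simp [hω]
    rwa [covMat_mulVec_right hX hY, Matrix.transpose_transpose] at h1
  -- By a Penrose condition the columns of `1 - V⁺ V` lie in the kernel of `V`.
  have := key (1 - pinv V * V) (by
    rw [Matrix.mul_sub, ← Matrix.mul_assoc, hp.mul_mul_self, Matrix.mul_one, sub_self])
  rw [Matrix.mul_sub, Matrix.mul_one, sub_eq_zero, ← Matrix.mul_assoc] at this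
  exact this.symm

end CovarianceMatrix

/-! ### The Gaussian laws `gauss` -/

section Gauss

variable {d e : ℕ}

theorem aestronglyMeasurable_apply {a : Type} (i : a) (P : Measure (a → ℝ)) :
    AEStronglyMeasurable (fun x : a → ℝ => x i) P :=
  (measurable_pi_apply i).aestronglyMeasurable

instance isGaussian_gauss (c : Fin d → ℝ) (S : Matrix (Fin d) (Fin d) ℝ) :
    IsGaussian (gauss c S) :=
  isGaussian_map_equiv (μ := multivariateGaussian (WithLp.toLp 2 c) S)
    (PiLp.continuousLinearEquiv 2 ℝ fun _ : Fin d => ℝ)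

theorem sqIntegrable_of_hasGaussianLaw {Ω a : Type} [MeasurableSpace Ω] [Fintype a]
    {P : Measure Ω} {X : Ω → a → ℝ} (hX : HasGaussianLaw X P) : SqIntegrable X P :=
  fun i => (hX.eval i).memLp_two

theorem sqIntegrable_id {a : Type} [Fintype a] (P : Measure (a → ℝ)) [IsGaussian P] :
    SqIntegrable (fun x : a → ℝ => x) P :=
  sqIntegrable_of_hasGaussianLaw (X := fun x => x) IsGaussian.hasGaussianLaw_id

theorem integral_gauss (c : Fin d → ℝ) (S : Matrix (Fin d) (Fin d) ℝ) (i : Fin d) :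
    ∫ x, x i ∂(gauss c S) = c i := by
  rw [gauss, integral_map (by fun_prop) (aestronglyMeasurable_apply _ _)]
  have h := integral_id_multivariateGaussian (μ := WithLp.toLp 2 c) (S := S)
  have h2 := (EuclideanSpace.proj (𝕜 := ℝ) i : EuclideanSpace ℝ (Fin d) →L[ℝ] ℝ).integral_comp_comm
    (IsGaussian.integrable_fun_id (μ := multivariateGaussian (WithLp.toLp 2 c) S))
  rw [h] at h2
  exact h2

theorem covMat_gauss (c : Fin d → ℝ) {S : Matrix (Fin d) (Fin d) ℝ} (hS : S.PosSemidef) :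
    covMat (fun x => x) (fun x => x) (gauss c S) = S := by
  ext i j
  rw [gauss, covMat, Matrix.of_apply, covariance_map (aestronglyMeasurable_apply _ _)
    (aestronglyMeasurable_apply _ _) (by fun_prop)]
  exact covariance_eval_multivariateGaussian hS i j

/-- A Gaussian law on `ℝ^d` is determined by its mean vector and its covariance matrix. -/
theorem isGaussian_ext {P P' : Measure (Fin d → ℝ)} [IsGaussian P] [IsGaussian P']
    (hm : ∀ i, ∫ x, x i ∂P = ∫ x, x i ∂P')
    (hc : covMat (fun x => x) (fun x => x) P = covMat (fun x => x) (fun x => x) P') : P = P' := by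
  -- Writing a functional as a one-row matrix `M` turns its mean into `M` times the mean and its
  -- variance into `M C Mᵀ`, the only data in the characteristic function.
  have hL : ∀ L : StrongDual ℝ (Fin d → ℝ), ∃ M : Matrix Unit (Fin d) ℝ,
      ∀ x, L x = (M *ᵥ x) () := fun L => by
    refine ⟨Matrix.of fun _ i => L (Pi.single i 1), fun x => ?_⟩
    have hx : L x = L (∑ i, x i • Pi.single i 1) := by
      congr 1; ext j; simp [Finset.sum_apply, Pi.single_apply]
    rw [hx, map_sum]
    simp [Matrix.mulVec, dotProduct, mul_comm]
  have hi : ∀ (ρ : Measure (Fin d → ℝ)) [IsGaussian ρ] (i : Fin d),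
      Integrable (fun x : Fin d → ℝ => x i) ρ :=
    fun ρ _ i => (sqIntegrable_id ρ i).integrable (by norm_num)
  refine Measure.ext_of_charFunDual ?_
  ext L
  obtain ⟨M, hM⟩ := hL L
  have e1 : ∀ (ρ : Measure (Fin d → ℝ)) [IsGaussian ρ],
      (∫ x, L x ∂ρ) = ∑ i, M () i * (∫ x, x i ∂ρ) := fun ρ _ => by
    simp only [hM, Matrix.mulVec, dotProduct]
    rw [integral_finsetSum _ fun i _ => (hi ρ i).const_mul _]
    simp only [integral_const_mul]
  have e2 : ∀ (ρ : Measure (Fin d → ℝ)) [IsGaussian ρ],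
      Var[L; ρ] = (M * covMat (fun x => x) (fun x => x) ρ * Mᵀ) () () := fun ρ _ => by
    rw [← covariance_self (by fun_prop),
      ← covMat_mulVec_left (sqIntegrable_id ρ) (sqIntegrable_id ρ),
      ← covMat_mulVec_right ((sqIntegrable_id ρ).mulVec M) (sqIntegrable_id ρ)]
    simp only [covMat, Matrix.of_apply]
    have : (L : (Fin d → ℝ) → ℝ) = fun x => (M *ᵥ x) () := funext hM
    rw [this]
  rw [IsGaussian.charFunDual_eq, IsGaussian.charFunDual_eq, e2 P, e2 P', hc]
  simp only [integral_complex_ofReal]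
  rw [e1 P, e1 P']
  simp only [hm]

theorem eq_gauss {P : Measure (Fin d → ℝ)} [IsGaussian P] {c : Fin d → ℝ}
    {S : Matrix (Fin d) (Fin d) ℝ} (hS : S.PosSemidef) (hm : ∀ i, ∫ x, x i ∂P = c i)
    (hc : covMat (fun x => x) (fun x => x) P = S) : P = gauss c S :=
  isGaussian_ext (fun i => by rw [hm, integral_gauss]) (by rw [hc, covMat_gauss _ hS])

theorem gauss_map_add (c v : Fin d → ℝ) (S : Matrix (Fin d) (Fin d) ℝ) :
    (gauss c S).map (fun x => v + x) = gauss (v + c) S := by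
  rw [gauss, gauss, Measure.map_map (by fun_prop) (by fun_prop), multivariateGaussian,
    multivariateGaussian, Measure.map_map (by fun_prop) (by fun_prop),
    Measure.map_map (by fun_prop) (by fun_prop)]
  congr 1
  ext x i
  simp [add_assoc]

theorem hasGaussianLaw_prod_id {E F : Type*} [NormedAddCommGroup E] [NormedSpace ℝ E]
    [MeasurableSpace E] [BorelSpace E] [CompleteSpace E] [SecondCountableTopology E]
    [NormedAddCommGroup F] [NormedSpace ℝ F] [MeasurableSpace F] [BorelSpace F] [CompleteSpace F]
    [SecondCountableTopology F] (P : Measure E) (R : Measure F) [IsGaussian P] [IsGaussian R] :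
    HasGaussianLaw (fun p : E × F => p) (P.prod R) := by
  have h1 : HasGaussianLaw (fun p : E × F => p.1) (P.prod R) :=
    ⟨by rw [Measure.map_fst_prod]; simp; infer_instance⟩
  have h2 : HasGaussianLaw (fun p : E × F => p.2) (P.prod R) :=
    ⟨by rw [Measure.map_snd_prod]; simp; infer_instance⟩
  exact IndepFun.hasGaussianLaw h1 h2
    (indepFun_prod (X := fun x : E => x) (Y := fun x : F => x) measurable_id measurable_id)

instance isGaussian_prod {E F : Type*} [NormedAddCommGroup E] [NormedSpace ℝ E]
    [MeasurableSpace E] [BorelSpace E] [CompleteSpace E] [SecondCountableTopology E]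
    [NormedAddCommGroup F] [NormedSpace ℝ F] [MeasurableSpace F] [BorelSpace F] [CompleteSpace F]
    [SecondCountableTopology F] (P : Measure E) (R : Measure F) [IsGaussian P] [IsGaussian R] :
    IsGaussian (P.prod R) := by
  have := (hasGaussianLaw_prod_id P R).isGaussian_map
  rwa [Measure.map_id'] at this

/-- The law of `M x + w` for independent centered Gaussian `x` and `w`. -/
theorem gauss_prod_map (M : Matrix (Fin e) (Fin d) ℝ) {S : Matrix (Fin d) (Fin d) ℝ}
    {R : Matrix (Fin e) (Fin e) ℝ} (hS : S.PosSemidef) (hR : R.PosSemidef) :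
    ((gauss 0 S).prod (gauss 0 R)).map (fun p => M *ᵥ p.1 + p.2) = gauss 0 (M * S * Mᵀ + R) := by
  set P := (gauss (0 : Fin d → ℝ) S).prod (gauss (0 : Fin e → ℝ) R) with hP
  have hid := hasGaussianLaw_prod_id (gauss (0 : Fin d → ℝ) S) (gauss (0 : Fin e → ℝ) R)
  have h1 : HasGaussianLaw (fun p : (Fin d → ℝ) × (Fin e → ℝ) => p.1) P := hid.fst
  have h2 : HasGaussianLaw (fun p : (Fin d → ℝ) × (Fin e → ℝ) => p.2) P := hid.snd
  have hg : HasGaussianLaw (fun p : (Fin d → ℝ) × (Fin e → ℝ) => M *ᵥ p.1 + p.2) P :=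
    hid.map ((M.mulVecLin.toContinuousLinearMap.comp
      (ContinuousLinearMap.fst ℝ (Fin d → ℝ) (Fin e → ℝ))) +
      ContinuousLinearMap.snd ℝ (Fin d → ℝ) (Fin e → ℝ))
  have hm := hg.isGaussian_map
  have hPS : (M * S * Mᵀ + R).PosSemidef := by
    refine Matrix.PosSemidef.add ?_ hR
    have := hS.mul_mul_conjTranspose_same M
    rwa [Matrix.conjTranspose_eq_transpose_of_trivial] at this
  have s1 := sqIntegrable_of_hasGaussianLaw h1
  have s2 := sqIntegrable_of_hasGaussianLaw h2
  have m1 : ∀ i, ∫ p, p.1 i ∂P = 0 := fun i => by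
    have := integral_map (μ := P) (φ := Prod.fst) (f := fun x : Fin d → ℝ => x i)
      (by fun_prop) (aestronglyMeasurable_apply _ _)
    rw [← this, hP, Measure.map_fst_prod]
    simp [integral_gauss]
  have m2 : ∀ i, ∫ p, p.2 i ∂P = 0 := fun i => by
    have := integral_map (μ := P) (φ := Prod.snd) (f := fun x : Fin e → ℝ => x i)
      (by fun_prop) (aestronglyMeasurable_apply _ _)
    rw [← this, hP, Measure.map_snd_prod]
    simp [integral_gauss]
  have hind : IndepFun (fun p : (Fin d → ℝ) × (Fin e → ℝ) => p.1) (fun p => p.2) P :=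
    indepFun_prod (X := fun x : Fin d → ℝ => x) (Y := fun x : Fin e → ℝ => x)
      measurable_id measurable_id
  refine eq_gauss hPS (fun i => ?_) ?_
  · rw [integral_map (by fun_prop) (aestronglyMeasurable_apply _ _)]
    simp only [Pi.add_apply, Matrix.mulVec, dotProduct]
    rw [integral_add, integral_finsetSum]
    · simp [integral_const_mul, m1, m2]
    · exact fun j _ => ((s1 j).integrable (by norm_num)).const_mul _
    · exact integrable_finsetSum _ fun j _ => ((s1 j).integrable (by norm_num)).const_mul _
    · exact (s2 i).integrable (by norm_num)
  · have c1 : covMat (fun p : (Fin d → ℝ) × (Fin e → ℝ) => p.1) (fun p => p.1) P = S := by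
      rw [← covMat_map (X := fun x => x) (Y := fun x => x) measurable_fst measurable_id
        measurable_id, hP, Measure.map_fst_prod]
      simp [covMat_gauss _ hS]
    have c2 : covMat (fun p : (Fin d → ℝ) × (Fin e → ℝ) => p.2) (fun p => p.2) P = R := by
      rw [← covMat_map (X := fun x => x) (Y := fun x => x) measurable_snd measurable_id
        measurable_id, hP, Measure.map_snd_prod]
      simp [covMat_gauss _ hR]
    have c3 := covMat_eq_zero_of_indepFun s1 s2 hind
    have c4 := covMat_eq_zero_of_indepFun s2 s1 hind.symm
    rw [covMat_map (by fun_prop) (by fun_prop) (by fun_prop),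
      covMat_add_left (s1.mulVec M) s2 ((s1.mulVec M).add s2),
      covMat_add_right (s1.mulVec M) (s1.mulVec M) s2, covMat_add_right s2 (s1.mulVec M) s2,
      covMat_mulVec_left s1 (s1.mulVec M), covMat_mulVec_right s1 s1, covMat_mulVec_left s1 s2,
      covMat_mulVec_right s2 s1, c1, c2, c3, c4]
    simp [Matrix.mul_assoc]

end Gauss

end LQG

namespace LQG

/-! ### Gaussian conditioning on type histories -/

theorem hasGaussianLaw_of_isLinearMap {E F : Type*} [NormedAddCommGroup E] [NormedSpace ℝ E]
    [MeasurableSpace E] [BorelSpace E] [FiniteDimensional ℝ E] [NormedAddCommGroup F]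
    [NormedSpace ℝ F] [MeasurableSpace F] [BorelSpace F] (P : Measure E) [IsGaussian P] {f : E → F}
    (hf : IsLinearMap ℝ f) : HasGaussianLaw f P :=
  (IsGaussian.hasGaussianLaw_id (μ := P)).map (hf.mk' f).toContinuousLinearMap

/-- This is Tonelli's theorem for the joint law: `R` may be replaced by an independent copy of
itself, which is how independence enters Bayes' rule. -/
theorem lintegral_indepFun {Ω β γ : Type*} [MeasurableSpace Ω] [MeasurableSpace β]
    [MeasurableSpace γ] {P : Measure Ω} [IsProbabilityMeasure P] {Y : Ω → β} {R : Ω → γ}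
    (hY : Measurable Y) (hR : Measurable R) (h : IndepFun Y R P) {f : β × γ → ℝ≥0∞}
    (hf : Measurable f) :
    ∫⁻ ω, f (Y ω, R ω) ∂P = ∫⁻ ω, ∫⁻ ω', f (Y ω, R ω') ∂P ∂P := by
  have h1 := (indepFun_iff_map_prod_eq_prod_map_map hY.aemeasurable hR.aemeasurable).1 h
  have h2 : ∫⁻ ω, f (Y ω, R ω) ∂P = ∫⁻ p, f p ∂(P.map fun ω => (Y ω, R ω)) :=
    (lintegral_map hf (hY.prodMk hR)).symm
  have := Measure.isProbabilityMeasure_map (μ := P) hR.aemeasurable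
  rw [h2, h1, lintegral_prod _ hf.aemeasurable, lintegral_map hf.lintegral_prod_right' hY]
  refine lintegral_congr fun ω => ?_
  rw [lintegral_map (by fun_prop) hR]

section Residual

variable {d e t : ℕ}

/-- The regression coefficients of the `k`-th entry of a history on `L` times its last entry. -/
def histGain (P : Measure (Fin (t + 1) → Fin d → ℝ)) (L : Matrix (Fin e) (Fin d) ℝ)
    (k : Fin (t + 1)) : Matrix (Fin d) (Fin e) ℝ :=
  covMat (fun z => z k) (fun z => z (Fin.last t)) P * Lᵀ *
    pinv (L * covMat (fun z => z (Fin.last t)) (fun z => z (Fin.last t)) P * Lᵀ)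

/-- The part of a history that is not explained by `L` times its last entry. -/
def resid (P : Measure (Fin (t + 1) → Fin d → ℝ)) (L : Matrix (Fin e) (Fin d) ℝ)
    (z : Fin (t + 1) → Fin d → ℝ) : Fin (t + 1) → Fin d → ℝ :=
  fun k => z k - histGain P L k *ᵥ (L *ᵥ z (Fin.last t))

theorem isLinearMap_resid (P : Measure (Fin (t + 1) → Fin d → ℝ)) (L : Matrix (Fin e) (Fin d) ℝ) :
    IsLinearMap ℝ (resid P L) where
  map_add x y := by
    ext1 k
    simp only [resid, Pi.add_apply, Matrix.mulVec_add]
    abel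
  map_smul c x := by
    ext1 k
    simp only [resid, Pi.smul_apply, Matrix.mulVec_smul, smul_sub]

@[fun_prop]
theorem continuous_resid (P : Measure (Fin (t + 1) → Fin d → ℝ)) (L : Matrix (Fin e) (Fin d) ℝ) :
    Continuous (resid P L) := by
  unfold resid
  fun_prop

@[fun_prop]
theorem measurable_resid (P : Measure (Fin (t + 1) → Fin d → ℝ)) (L : Matrix (Fin e) (Fin d) ℝ) :
    Measurable (resid P L) := (continuous_resid P L).measurable

/-- The regression coefficients are chosen so that the residual is uncorrelated with the regressor;
both are linear images of one Gaussian vector, so this is independence. The covariance of the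
regressor may be singular: the identity `covMat_mul_pinv_mul` replaces invertibility. -/
theorem indepFun_resid (P : Measure (Fin (t + 1) → Fin d → ℝ)) [IsGaussian P]
    (L : Matrix (Fin e) (Fin d) ℝ) :
    IndepFun (fun z => L *ᵥ z (Fin.last t)) (resid P L) P := by
  have hk : ∀ k, SqIntegrable (fun z : Fin (t + 1) → Fin d → ℝ => z k) P := fun k =>
    sqIntegrable_of_hasGaussianLaw
      (hasGaussianLaw_of_isLinearMap P ⟨fun _ _ => rfl, fun _ _ => rfl⟩)
  have hL := (hk (Fin.last t)).mulVec L
  -- The residual history is flattened to a family of real coordinates, to which the criterion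
  -- "jointly Gaussian and uncorrelated implies independent" applies; it is curried back at the end.
  have hj : HasGaussianLaw (fun z : Fin (t + 1) → Fin d → ℝ =>
      ((fun i => (L *ᵥ z (Fin.last t)) i),
        (fun p : Fin (t + 1) × Fin d => resid P L z p.1 p.2))) P := by
    refine hasGaussianLaw_of_isLinearMap P ⟨fun x y => ?_, fun c x => ?_⟩
    · refine Prod.ext ?_ ?_
      · simp [Matrix.mulVec_add]; rfl
      · ext p; simp [(isLinearMap_resid P L).map_add]
    · refine Prod.ext ?_ ?_
      · simp [Matrix.mulVec_smul]; rfl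
      · ext p; simp [(isLinearMap_resid P L).map_smul]
  have h := hj.indepFun_of_covariance_eval (X := fun i z => (L *ᵥ z (Fin.last t)) i)
    (Y := fun (p : Fin (t + 1) × Fin d) z => resid P L z p.1 p.2) fun i p => by
    have hc : covMat (fun z : Fin (t + 1) → Fin d → ℝ => L *ᵥ z (Fin.last t))
        (fun z => resid P L z p.1) P = 0 := by
      rw [← covMat_transpose]
      unfold resid
      rw [covMat_sub_left (hk _) (hL.mulVec _) hL, covMat_mulVec_left hL hL, sub_eq_zero.2,
        Matrix.transpose_zero]
      have := covMat_mul_pinv_mul (hk p.1) hL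
      rw [← this]
      congr 1
      rw [histGain, covMat_mulVec_right (hk _) (hk _), covMat_mulVec_right hL (hk _),
        covMat_mulVec_left (hk _) (hk _)]
    exact congrFun (congrFun hc i) p.2
  exact h.comp (φ := id) (ψ := fun (w : Fin (t + 1) × Fin d → ℝ) k a => w (k, a)) measurable_id
    (by fun_prop)

end Residual

/-! ### Pairs of vectors -/

theorem opp_ne (i : Fin 2) : opp i ≠ i := by fin_cases i <;> decide

theorem eq_opp {i j : Fin 2} (h : i ≠ j) : j = opp i := by
  revert h; fin_cases i <;> fin_cases j <;> decide

section PairUp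

variable {d : Fin 2 → ℕ} (i : Fin 2)

/-- The pair of vectors with the given components of player `i` and of the other player. -/
def pairUp (a : Fin (d i) → ℝ) (b : Fin (d (opp i)) → ℝ) : Joint d :=
  Function.update (Function.update 0 i a) (opp i) b

@[simp]
theorem pairUp_self (a : Fin (d i) → ℝ) (b : Fin (d (opp i)) → ℝ) : pairUp i a b i = a := by
  rw [pairUp, Function.update_of_ne (opp_ne i).symm, Function.update_self]

@[simp]
theorem pairUp_opp (a : Fin (d i) → ℝ) (b : Fin (d (opp i)) → ℝ) : pairUp i a b (opp i) = b := by
  rw [pairUp, Function.update_self]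

theorem joint_ext {v w : Joint d} (h1 : v i = w i) (h2 : v (opp i) = w (opp i)) : v = w := by
  funext j
  by_cases h : i = j
  · subst h; exact h1
  · obtain rfl := eq_opp h; exact h2

@[fun_prop]
theorem continuous_pairUp {X : Type*} [TopologicalSpace X] {f : X → Fin (d i) → ℝ}
    {g : X → Fin (d (opp i)) → ℝ} (hf : Continuous f) (hg : Continuous g) :
    Continuous fun x => pairUp i (f x) (g x) :=
  (continuous_const.update i hf).update (opp i) hg

@[fun_prop]
theorem measurable_pairUp {X : Type*} [MeasurableSpace X] {f : X → Fin (d i) → ℝ}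
    {g : X → Fin (d (opp i)) → ℝ} (hf : Measurable f) (hg : Measurable g) :
    Measurable fun x => pairUp i (f x) (g x) :=
  (continuous_pairUp i (f := Prod.fst) (g := Prod.snd) continuous_fst
    continuous_snd).measurable.comp (hf.prodMk hg)

@[fun_prop]
theorem continuous_stack : Continuous (stack (d := d)) := by
  unfold stack; fun_prop

@[fun_prop]
theorem measurable_stack : Measurable (stack (d := d)) := continuous_stack.measurable

end PairUp

/-! ### Kernels that push a fixed law forward -/

section PushKernel

variable {α β γ : Type*} [MeasurableSpace α] [MeasurableSpace β] [MeasurableSpace γ]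

/-- The law of `F (a, b)` for `b` with the law `P`, as a kernel in `a`. -/
def pushKernel (F : α × β → γ) (P : Measure β) : Kernel α γ :=
  (Kernel.id ×ₖ Kernel.const α P).map F

theorem pushKernel_apply {F : α × β → γ} (hF : Measurable F) (P : Measure β) [SFinite P] (a : α) :
    pushKernel F P a = P.map fun b => F (a, b) := by
  rw [pushKernel, Kernel.map_apply _ hF, Kernel.prod_apply, Kernel.id_apply, Kernel.const_apply,
    Measure.dirac_prod, Measure.map_map hF (by fun_prop)]
  rfl

theorem isMarkovKernel_pushKernel {F : α × β → γ} (hF : Measurable F) (P : Measure β)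
    [IsProbabilityMeasure P] : IsMarkovKernel (pushKernel F P) :=
  Kernel.IsMarkovKernel.map _ hF

end PushKernel

/-! ### The beliefs about type histories -/

theorem measurable_snoc {X : Type*} [MeasurableSpace X] {t : ℕ} {α : Type*} [MeasurableSpace α]
    {f : X → Fin t → α} {g : X → α} (hf : Measurable f) (hg : Measurable g) :
    Measurable fun x => (Fin.snoc (α := fun _ => α) (f x) (g x) : Fin (t + 1) → α) := by
  refine measurable_pi_lambda _ fun k => ?_
  refine Fin.lastCases ?_ (fun k => ?_) k
  · simpa using hg
  · simpa [Function.comp_def] using (measurable_pi_apply k).comp hf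

theorem snoc_add_snoc {t : ℕ} {α : Type*} [Add α] (f g : Fin t → α) (a b : α) :
    (Fin.snoc (α := fun _ => α) f a : Fin (t + 1) → α) + Fin.snoc (α := fun _ => α) g b =
      Fin.snoc (α := fun _ => α) (f + g) (a + b) := by
  funext k
  refine Fin.lastCases ?_ (fun k => ?_) k <;> simp

theorem smul_snoc {t : ℕ} {R α : Type*} [SMul R α] (c : R) (f : Fin t → α) (a : α) :
    c • (Fin.snoc (α := fun _ => α) f a : Fin (t + 1) → α) =
      Fin.snoc (α := fun _ => α) (c • f) (c • a) := by
  funext k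
  refine Fin.lastCases ?_ (fun k => ?_) k <;> simp

namespace Game

variable {n m : Fin 2 → ℕ} (G : Game n m) (θ : GenFun n m)

theorem cov_posSemidef (t : ℕ) (j : Fin 2) : (G.cov θ t j).PosSemidef := by
  induction t with
  | zero => exact G.S₁_posSemidef j
  | succ t ih =>
    refine Matrix.PosSemidef.add ?_ (G.Q_posSemidef j)
    set R := G.A t j * (1 - gain (G.cov θ t) (θ.L t (G.cov θ t)) j * θ.L t (G.cov θ t) j)
    have h := ih.mul_mul_conjTranspose_same R
    rw [Matrix.conjTranspose_eq_transpose_of_trivial, Matrix.transpose_mul] at h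
    rw [Matrix.mul_assoc]
    exact h

/-- The centered law of the type history of player `j` in the common belief. -/
def noiseLaw (j : Fin 2) : (t : ℕ) → Measure (TypeHist n j t)
  | 0 => (gauss (0 : Fin (n j) → ℝ) (G.S₁ j)).map fun x _ => x
  | t + 1 => ((noiseLaw j t).prod (gauss (0 : Fin (n j) → ℝ) (G.Q j))).map fun p =>
      Fin.snoc (α := fun _ => Fin (n j) → ℝ)
        (resid (noiseLaw j t) (θ.L t (G.cov θ t) j) p.1)
        (G.A t j *ᵥ resid (noiseLaw j t) (θ.L t (G.cov θ t) j) p.1 (Fin.last t) + p.2)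

instance isGaussian_noiseLaw (j : Fin 2) (t : ℕ) : IsGaussian (G.noiseLaw θ j t) := by
  induction t with
  | zero =>
    exact (hasGaussianLaw_of_isLinearMap _ ⟨fun _ _ => rfl, fun _ _ => rfl⟩).isGaussian_map
  | succ t ih =>
    refine (hasGaussianLaw_of_isLinearMap _ ⟨fun x y => ?_, fun c x => ?_⟩).isGaussian_map
    · rw [snoc_add_snoc]
      congr 1
      · exact (isLinearMap_resid _ _).map_add _ _
      · rw [Prod.fst_add, (isLinearMap_resid _ _).map_add, Pi.add_apply, Matrix.mulVec_add,
          Prod.snd_add]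
        abel
    · rw [smul_snoc]
      congr 1
      · exact (isLinearMap_resid _ _).map_smul _ _
      · rw [Prod.smul_fst, (isLinearMap_resid _ _).map_smul, Pi.smul_apply, Matrix.mulVec_smul,
          Prod.smul_snd, smul_add]

/-- The assumption is the conclusion of `noiseLaw_map_last` at the same stage; it is kept as an
assumption so as to be available inside the induction that proves it. -/
theorem covMat_noiseLaw_last {j : Fin 2} {t : ℕ}
    (h : (G.noiseLaw θ j t).map (fun z => z (Fin.last t)) =
      gauss (0 : Fin (n j) → ℝ) (G.cov θ t j)) :
    covMat (fun z : TypeHist n j t => z (Fin.last t)) (fun z => z (Fin.last t)) (G.noiseLaw θ j t) =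
      G.cov θ t j := by
  rw [← covMat_map (X := fun x : Fin (n j) → ℝ => x) (Y := fun x => x)
    (f := fun z : TypeHist n j t => z (Fin.last t)) (by fun_prop) measurable_id measurable_id, h,
    covMat_gauss _ (G.cov_posSemidef θ t j)]

/-- The last entry of the next history is `A (1 - G L) z + w`, with `z` the present last entry and
`w` an independent noise; its covariance is exactly the update `φ_s`. -/
theorem noiseLaw_map_last (j : Fin 2) (t : ℕ) :
    (G.noiseLaw θ j t).map (fun z => z (Fin.last t)) =
      gauss (0 : Fin (n j) → ℝ) (G.cov θ t j) := by
  induction t with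
  | zero =>
    rw [noiseLaw, Measure.map_map (by fun_prop) (by fun_prop)]
    exact Measure.map_id
  | succ t ih =>
    set L := θ.L t (G.cov θ t) j with hL
    set K := gain (G.cov θ t) (θ.L t (G.cov θ t)) j with hK
    -- At the last entry the regression coefficient of the history is the gain of the construction,
    -- since by induction the covariance of that entry is `Σ_t`.
    have hG : histGain (G.noiseLaw θ j t) L (Fin.last t) = K := by
      rw [histGain, G.covMat_noiseLaw_last θ ih]
      rfl
    have hr : ∀ z : TypeHist n j t, resid (G.noiseLaw θ j t) L z (Fin.last t) =
        (1 - K * L) *ᵥ z (Fin.last t) := fun z => by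
      rw [resid, hG, Matrix.sub_mulVec, Matrix.one_mulVec, Matrix.mulVec_mulVec]
    have hmeas : Measurable fun p : TypeHist n j t × (Fin (n j) → ℝ) =>
        (Fin.snoc (α := fun _ => Fin (n j) → ℝ) (resid (G.noiseLaw θ j t) L p.1)
          (G.A t j *ᵥ resid (G.noiseLaw θ j t) L p.1 (Fin.last t) + p.2) : TypeHist n j (t + 1)) :=
      measurable_snoc (by fun_prop) (by fun_prop)
    rw [noiseLaw, Measure.map_map (by fun_prop) hmeas]
    have h1 : ((gauss (0 : Fin (n j) → ℝ) (G.cov θ t j)).prod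
        (gauss (0 : Fin (n j) → ℝ) (G.Q j))) =
        ((G.noiseLaw θ j t).prod (gauss (0 : Fin (n j) → ℝ) (G.Q j))).map
          (Prod.map (fun z => z (Fin.last t)) id) := by
      rw [← Measure.map_prod_map _ _ (by fun_prop) measurable_id, ih, Measure.map_id]
    have h2 := gauss_prod_map (G.A t j * (1 - K * L)) (G.cov_posSemidef θ t j) (G.Q_posSemidef j)
    rw [h1, Measure.map_map (by fun_prop) (by fun_prop)] at h2
    have h3 : G.cov θ (t + 1) j = G.A t j * (1 - K * L) * G.cov θ t j *
        (G.A t j * (1 - K * L))ᵀ + G.Q j := by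
      rw [Matrix.transpose_mul, ← Matrix.mul_assoc]; rfl
    rw [h3, ← h2]
    congr 1
    funext p
    simp only [Function.comp_apply, Fin.snoc_last, Prod.map_fst, Prod.map_snd, id_eq, hr,
      Matrix.mulVec_mulVec]

theorem histGain_noiseLaw_last (j : Fin 2) (t : ℕ) :
    histGain (G.noiseLaw θ j t) (θ.L t (G.cov θ t) j) (Fin.last t) =
      gain (G.cov θ t) (θ.L t (G.cov θ t)) j := by
  rw [histGain, G.covMat_noiseLaw_last θ (G.noiseLaw_map_last θ j t)]
  rfl

/-- The expectation of the action of player `j` in the common belief. -/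
def meanAction (j : Fin 2) (t : ℕ) (u : PubHist m t) : Fin (m j) → ℝ :=
  θ.L t (G.cov θ t) j *ᵥ G.mean θ t u j + θ.M t (G.cov θ t) j *ᵥ stack (G.mean θ t u)

@[fun_prop]
theorem measurable_mean (t : ℕ) : Measurable (G.mean θ t) := (G.continuous_mean θ t).measurable

@[fun_prop]
theorem measurable_meanAction (j : Fin 2) (t : ℕ) : Measurable (G.meanAction θ j t) := by
  unfold meanAction
  fun_prop

/-- The mean of the type history of player `j` after the observation of the action `a` of `j`. -/
def postMean (j : Fin 2) (t : ℕ) (x : TypeHist n j t) (u : PubHist m t) (a : Fin (m j) → ℝ) :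
    TypeHist n j t :=
  fun k => x k + histGain (G.noiseLaw θ j t) (θ.L t (G.cov θ t) j) k *ᵥ (a - G.meanAction θ j t u)

/-- The mean of the type history of player `j` in the common belief. -/
def histMean (j : Fin 2) : (t : ℕ) → PubHist m t → TypeHist n j t
  | 0, _ => 0
  | t + 1, u =>
    Fin.snoc (α := fun _ => Fin (n j) → ℝ)
      (G.postMean θ j t (histMean j t fun k => u k.castSucc) (fun k => u k.castSucc)
        (u (Fin.last t) j))
      (G.A t j *ᵥ G.postMean θ j t (histMean j t fun k => u k.castSucc) (fun k => u k.castSucc)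
        (u (Fin.last t) j) (Fin.last t) + G.B t j *ᵥ stack (u (Fin.last t)))

/-- The update of the history mean involves the innovation `a - L x̂ - M x̂`; at the last entry its
coefficient is the gain, which gives `φ_x`. -/
theorem histMean_last (j : Fin 2) (t : ℕ) (u : PubHist m t) :
    G.histMean θ j t u (Fin.last t) = G.mean θ t u j := by
  induction t with
  | zero => rfl
  | succ t ih =>
    rw [histMean, Fin.snoc_last, postMean, ih, histGain_noiseLaw_last, Matrix.mulVec_add,
      Matrix.mulVec_mulVec, mean, meanUpdate, meanAction, sub_sub]
    abel

@[fun_prop]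
theorem measurable_postMean (j : Fin 2) (t : ℕ) {X : Type*} [MeasurableSpace X]
    {x : X → TypeHist n j t} {u : X → PubHist m t} {a : X → Fin (m j) → ℝ} (hx : Measurable x)
    (hu : Measurable u) (ha : Measurable a) :
    Measurable fun y => G.postMean θ j t (x y) (u y) (a y) := by
  unfold postMean
  have h := (G.measurable_meanAction θ j t).comp hu
  have h' : Measurable fun y => a y - G.meanAction θ j t (u y) := ha.sub h
  refine measurable_pi_lambda _ fun k => ?_
  refine Measurable.add (by fun_prop) ?_
  exact (Continuous.matrix_mulVec continuous_const continuous_id).measurable.comp h'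

@[fun_prop]
theorem measurable_histMean (j : Fin 2) (t : ℕ) : Measurable (G.histMean θ j t) := by
  induction t with
  | zero => exact measurable_const
  | succ t ih =>
    have h1 : Measurable fun u : PubHist m (t + 1) => G.postMean θ j t
        (G.histMean θ j t fun k => u k.castSucc) (fun k => u k.castSucc) (u (Fin.last t) j) :=
      G.measurable_postMean θ j t (ih.comp (by fun_prop)) (by fun_prop) (by fun_prop)
    have h2 : Measurable fun u : PubHist m (t + 1) => G.postMean θ j t
        (G.histMean θ j t fun k => u k.castSucc) (fun k => u k.castSucc) (u (Fin.last t) j)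
        (Fin.last t) := (measurable_pi_apply _).comp h1
    exact measurable_snoc h1 (by fun_prop)

/-- The common belief about the type history of player `j`. -/
def histBelief (j : Fin 2) (t : ℕ) : Kernel (PubHist m t) (TypeHist n j t) :=
  pushKernel (fun p => G.histMean θ j t p.1 + p.2) (G.noiseLaw θ j t)

/-- The belief about the type history of player `j` after the observation of the action of `j`. -/
def histPost (j : Fin 2) (t : ℕ) : Kernel (PubHist m t × (Fin (m j) → ℝ)) (TypeHist n j t) :=
  pushKernel (fun p => G.postMean θ j t (G.histMean θ j t p.1.1) p.1.1 p.1.2 +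
    resid (G.noiseLaw θ j t) (θ.L t (G.cov θ t) j) p.2) (G.noiseLaw θ j t)

/-- A complete history, from the private history of player `i` and the types of the other one. -/
def combine (i : Fin 2) {t : ℕ} (h : PrivHist n m i t) (z : TypeHist n (opp i) t) : Hist n m t :=
  (h.1, fun k => pairUp i (h.2 k) (z k))

@[fun_prop]
theorem measurable_combine (i : Fin 2) {t : ℕ} {X : Type*} [MeasurableSpace X]
    {h : X → PrivHist n m i t} {z : X → TypeHist n (opp i) t} (hh : Measurable h)
    (hz : Measurable z) : Measurable fun x => combine i (h x) (z x) := by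
  unfold combine
  fun_prop

@[fun_prop]
theorem measurable_priv (i : Fin 2) (t : ℕ) : Measurable (Hist.priv (n := n) (m := m) (t := t) i) := by
  unfold Hist.priv Hist.types
  fun_prop

@[fun_prop]
theorem measurable_types (i : Fin 2) (t : ℕ) :
    Measurable (Hist.types (n := n) (m := m) (t := t) i) := by
  unfold Hist.types
  fun_prop

/-- The belief system of the equilibrium. -/
def beliefs : BeliefSystem n m := fun i t =>
  pushKernel (fun p => combine i p.1 (G.histMean θ (opp i) t p.1.1 + p.2)) (G.noiseLaw θ (opp i) t)

theorem measurable_histBelief_fun (j : Fin 2) (t : ℕ) :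
    Measurable fun p : PubHist m t × TypeHist n j t => G.histMean θ j t p.1 + p.2 := by
  fun_prop

theorem measurable_histPost_fun (j : Fin 2) (t : ℕ) :
    Measurable fun p : (PubHist m t × (Fin (m j) → ℝ)) × TypeHist n j t =>
      G.postMean θ j t (G.histMean θ j t p.1.1) p.1.1 p.1.2 +
        resid (G.noiseLaw θ j t) (θ.L t (G.cov θ t) j) p.2 := by
  refine Measurable.add ?_ (by fun_prop)
  exact G.measurable_postMean θ j t (by fun_prop) (by fun_prop) (by fun_prop)

theorem measurable_beliefs_fun (i : Fin 2) (t : ℕ) :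
    Measurable fun p : PrivHist n m i t × TypeHist n (opp i) t =>
      combine i p.1 (G.histMean θ (opp i) t p.1.1 + p.2) := by
  fun_prop

theorem beliefs_apply (i : Fin 2) (t : ℕ) (h : PrivHist n m i t) :
    G.beliefs θ i t h = (G.noiseLaw θ (opp i) t).map fun z =>
      combine i h (G.histMean θ (opp i) t h.1 + z) :=
  pushKernel_apply (G.measurable_beliefs_fun θ i t) _ h

theorem histBelief_apply (j : Fin 2) (t : ℕ) (u : PubHist m t) :
    G.histBelief θ j t u = (G.noiseLaw θ j t).map fun z => G.histMean θ j t u + z :=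
  pushKernel_apply (G.measurable_histBelief_fun θ j t) _ u

theorem histPost_apply (j : Fin 2) (t : ℕ) (p : PubHist m t × (Fin (m j) → ℝ)) :
    G.histPost θ j t p = (G.noiseLaw θ j t).map fun z =>
      G.postMean θ j t (G.histMean θ j t p.1) p.1 p.2 +
        resid (G.noiseLaw θ j t) (θ.L t (G.cov θ t) j) z :=
  pushKernel_apply (G.measurable_histPost_fun θ j t) _ p

theorem action_histMean_add (j : Fin 2) (t : ℕ) (u : PubHist m t) (z : TypeHist n j t) :
    G.action θ j t (u, G.histMean θ j t u + z) =
      G.meanAction θ j t u + θ.L t (G.cov θ t) j *ᵥ z (Fin.last t) := by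
  simp only [action, Pi.add_apply, histMean_last, meanAction, Matrix.mulVec_add]
  abel

/-- Bayes' rule for one observed action. -/
theorem lintegral_bayes (j : Fin 2) (t : ℕ) (u : PubHist m t)
    {f : (Fin (m j) → ℝ) × TypeHist n j t → ℝ≥0∞} (hf : Measurable f) :
    ∫⁻ z, f (G.action θ j t (u, G.histMean θ j t u + z), G.histMean θ j t u + z)
        ∂(G.noiseLaw θ j t) =
      ∫⁻ z, ∫⁻ z', f (G.action θ j t (u, G.histMean θ j t u + z),
        G.postMean θ j t (G.histMean θ j t u) u (G.action θ j t (u, G.histMean θ j t u + z)) +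
          resid (G.noiseLaw θ j t) (θ.L t (G.cov θ t) j) z') ∂(G.noiseLaw θ j t)
        ∂(G.noiseLaw θ j t) := by
  set P := G.noiseLaw θ j t
  set L := θ.L t (G.cov θ t) j
  -- `F` rebuilds the action and the type history from `L z` and the residual: the regression shift
  -- in `postMean` restores what the residual lacks. Independence then allows a fresh residual.
  set F : (Fin (m j) → ℝ) × TypeHist n j t → (Fin (m j) → ℝ) × TypeHist n j t := fun p =>
    (G.meanAction θ j t u + p.1,
      G.postMean θ j t (G.histMean θ j t u) u (G.meanAction θ j t u + p.1) + p.2) with hF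
  have hFm : Measurable F := by
    refine Measurable.prodMk (by fun_prop) (Measurable.add ?_ measurable_snd)
    exact G.measurable_postMean θ j t measurable_const measurable_const (by fun_prop)
  have h := lintegral_indepFun (f := fun p => f (F p)) (by fun_prop) (by fun_prop)
    (indepFun_resid P L) (hf.comp hFm)
  have e1 : ∀ z, F (L *ᵥ z (Fin.last t), resid P L z) =
      (G.action θ j t (u, G.histMean θ j t u + z), G.histMean θ j t u + z) := fun z => by
    rw [action_histMean_add]
    refine Prod.ext rfl (funext fun k => ?_)
    simp only [hF, postMean, resid, Pi.add_apply, add_sub_cancel_left]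
    abel
  simp only [e1] at h
  rw [h]
  simp only [hF, action_histMean_add]
  rfl

end Game

end LQG

/-! ### Consistency of the belief system -/

namespace LQG

namespace Game

variable {n m : Fin 2 → ℕ} (G : Game n m) (θ : GenFun n m)

instance isMarkovKernel_beliefs (i : Fin 2) (t : ℕ) : IsMarkovKernel (G.beliefs θ i t) :=
  isMarkovKernel_pushKernel (G.measurable_beliefs_fun θ i t) _

instance isMarkovKernel_histBelief (j : Fin 2) (t : ℕ) : IsMarkovKernel (G.histBelief θ j t) :=
  isMarkovKernel_pushKernel (G.measurable_histBelief_fun θ j t) _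

instance isMarkovKernel_histPost (j : Fin 2) (t : ℕ) : IsMarkovKernel (G.histPost θ j t) :=
  isMarkovKernel_pushKernel (G.measurable_histPost_fun θ j t) _

instance isMarkovKernel_betaStar (i : Fin 2) (t : ℕ) : IsMarkovKernel (G.betaStar θ i t) := by
  unfold betaStar
  infer_instance

theorem measurable_nextType (t : ℕ) (j : Fin 2) {X : Type*} [MeasurableSpace X]
    {x : X → Fin (n j) → ℝ} {u : X → Joint m} {w : X → Fin (n j) → ℝ} (hx : Measurable x)
    (hu : Measurable u) (hw : Measurable w) :
    Measurable fun y => G.nextType t j (x y) (u y) (w y) := by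
  have hc : Continuous fun p : (Fin (n j) → ℝ) × Joint m × (Fin (n j) → ℝ) =>
      G.nextType t j p.1 p.2.1 p.2.2 := by
    unfold nextType
    have : Continuous fun p : (Fin (n j) → ℝ) × Joint m × (Fin (n j) → ℝ) => stack p.2.1 := by
      fun_prop
    fun_prop
  exact hc.measurable.comp (hx.prodMk (hu.prodMk hw))

theorem histBelief_zero (j : Fin 2) (u : PubHist m 0) :
    G.histBelief θ j 0 u = (gauss (0 : Fin (n j) → ℝ) (G.S₁ j)).map fun x _ => x := by
  rw [histBelief_apply]
  simp only [histMean, zero_add]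
  exact Measure.map_id

/-- The update of the common belief by the transition law. -/
theorem histBelief_succ (j : Fin 2) (t : ℕ) (u : PubHist m t) (a : Joint m) :
    G.histBelief θ j (t + 1) (Fin.snoc (α := fun _ => Joint m) u a) =
      ((G.histPost θ j t (u, a j)).prod (gauss (0 : Fin (n j) → ℝ) (G.Q j))).map
        fun p => Fin.snoc (α := fun _ => Fin (n j) → ℝ) p.1
          (G.nextType t j (p.1 (Fin.last t)) a p.2) := by
  have hs : Measurable fun p : TypeHist n j t × (Fin (n j) → ℝ) =>
      (Fin.snoc (α := fun _ => Fin (n j) → ℝ) p.1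
        (G.nextType t j (p.1 (Fin.last t)) a p.2) : TypeHist n j (t + 1)) :=
    measurable_snoc measurable_fst
      (G.measurable_nextType t j (by fun_prop) measurable_const measurable_snd)
  have hm : Measurable fun p : TypeHist n j t × (Fin (n j) → ℝ) =>
      (Fin.snoc (α := fun _ => Fin (n j) → ℝ)
        (resid (G.noiseLaw θ j t) (θ.L t (G.cov θ t) j) p.1)
        (G.A t j *ᵥ resid (G.noiseLaw θ j t) (θ.L t (G.cov θ t) j) p.1 (Fin.last t) + p.2) :
          TypeHist n j (t + 1)) := measurable_snoc (by fun_prop) (by fun_prop)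
  rw [histBelief_apply, histPost_apply, noiseLaw, Measure.map_map (by fun_prop) hm]
  conv_rhs => rw [← Measure.map_id (μ := gauss (0 : Fin (n j) → ℝ) (G.Q j))]
  rw [Measure.map_prod_map _ _ (by fun_prop) measurable_id,
    Measure.map_map hs (by fun_prop)]
  congr 1
  funext p
  simp only [Function.comp_apply, histMean, Fin.snoc_last, Fin.snoc_castSucc, snoc_add_snoc,
    Prod.map_fst, Prod.map_snd, id_eq, nextType]
  congr 1
  rw [Pi.add_apply, Matrix.mulVec_add]
  abel

/-- Tested against nonnegative functions, this is `lintegral_bayes`, the prescribed action being a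
point mass. No property of the public history is needed, so it holds off the equilibrium path as
well. -/
theorem histBelief_bayes (j : Fin 2) (t : ℕ) (u : PubHist m t) :
    ((G.histBelief θ j t u) ⊗ₘ ((G.betaStar θ j t).sectR u)).map Prod.swap =
      ((G.histBelief θ j t u).bind ((G.betaStar θ j t).sectR u)) ⊗ₘ
        ((G.histPost θ j t).sectR u) := by
  have hadd : Measurable fun z : TypeHist n j t => G.histMean θ j t u + z := by fun_prop
  refine Measure.ext_of_lintegral _ fun f hf => ?_
  have hf1 : Measurable fun p : TypeHist n j t × (Fin (m j) → ℝ) => f p.swap := by fun_prop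
  have hf2 : Measurable fun a => ∫⁻ x, f (a, x) ∂((G.histPost θ j t).sectR u a) := by
    have := Measurable.lintegral_kernel_prod_right (κ := (G.histPost θ j t).sectR u)
      (f := fun a x => f (a, x)) (by simpa [Function.uncurry_def] using hf)
    exact this
  rw [lintegral_map hf measurable_swap, Measure.lintegral_compProd hf1,
    Measure.lintegral_compProd hf, Measure.lintegral_bind (Kernel.aemeasurable _)
      hf2.aemeasurable, histBelief_apply, lintegral_map _ hadd, lintegral_map _ hadd]
  · simp only [Kernel.sectR_apply, betaStar, Kernel.deterministic_apply, Prod.swap_prod_mk,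
      histPost_apply]
    have hd : ∀ x, Measurable fun a => f (a, x) := fun x => by fun_prop
    have hd2 := hf2
    simp only [Kernel.sectR_apply, histPost_apply] at hd2
    simp only [lintegral_dirac' _ (hd _), lintegral_dirac' _ hd2]
    rw [G.lintegral_bayes θ j t u hf]
    refine lintegral_congr fun z => ?_
    rw [lintegral_map (by fun_prop) (by fun_prop)]
  · exact Measurable.lintegral_kernel hf2
  · exact Measurable.lintegral_kernel_prod_right (κ := (G.betaStar θ j t).sectR u)
      (f := fun x a => f (a, x)) hf1

theorem isConsistent_betaStar : G.IsConsistent (G.betaStar θ) (G.beliefs θ) where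
  markov := inferInstance
  known i t _ h := by
    have hs : MeasurableSet {h' : Hist n m t | Hist.priv i h' = h} :=
      measurable_priv i t (measurableSet_singleton h)
    rw [beliefs_apply, ae_map_iff (by fun_prop) hs]
    refine Filter.Eventually.of_forall fun z => ?_
    refine Prod.ext rfl (funext fun k => ?_)
    exact pairUp_self i _ _
  bayes := by
    refine ⟨G.histBelief θ, G.histPost θ, inferInstance, inferInstance, ?_, G.histBelief_zero θ,
      fun j t _ u => G.histBelief_bayes θ j t u, fun j t _ u a => G.histBelief_succ θ j t u a⟩
    intro i j hij t _ h
    obtain rfl := eq_opp hij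
    rw [beliefs_apply, histBelief_apply, Measure.map_map (by fun_prop) (by fun_prop)]
    congr 1
    funext z k
    exact pairUp_opp i _ _

/-- The belief is a translate of the noise law, and the last entries of the translation and of the
noise are governed by `histMean_last` and `noiseLaw_map_last`. -/
theorem beliefs_map_last (i j : Fin 2) (hij : i ≠ j) (t : ℕ) (h : PrivHist n m i t) :
    (G.beliefs θ i t h).map (fun h' => h'.2 (Fin.last t) j) = G.muStar θ j t h.1 := by
  obtain rfl := eq_opp hij
  rw [beliefs_apply, Measure.map_map (by fun_prop) (by fun_prop), muStar,
    ← add_zero (G.mean θ t h.1 (opp i)), ← gauss_map_add, ← noiseLaw_map_last,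
    Measure.map_map (by fun_prop) (by fun_prop)]
  congr 1
  funext z
  simp only [Function.comp_apply, combine, pairUp_opp, Pi.add_apply, histMean_last]

end Game

end LQG

namespace LQG

/-! ### Lower bounds for expectations that may be infinite or undefined -/

section LowerBound

variable {Ω : Type} [MeasurableSpace Ω] {P : Measure Ω} {f g : Ω → ℝ} {c : ℝ}

/-- The expectation of `f`, if it is defined, is at least `c`. -/
def LowerBound (P : Measure Ω) (f : Ω → ℝ) (c : ℝ) : Prop :=
  ENNReal.ofReal c + ∫⁻ ω, ENNReal.ofReal (-f ω) ∂P ≤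
    ∫⁻ ω, ENNReal.ofReal (f ω) ∂P + ENNReal.ofReal (-c)

theorem integrable_of_lintegral_ofReal (hf : Measurable f)
    (h1 : ∫⁻ ω, ENNReal.ofReal (f ω) ∂P ≠ ⊤) (h2 : ∫⁻ ω, ENNReal.ofReal (-f ω) ∂P ≠ ⊤) :
    Integrable f P := by
  refine ⟨hf.aestronglyMeasurable, ?_⟩
  have he : ∀ x : ℝ, ‖x‖ₑ = ENNReal.ofReal x + ENNReal.ofReal (-x) := fun x => by
    rw [Real.enorm_eq_ofReal_abs]
    rcases le_total 0 x with hx | hx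
    · rw [abs_of_nonneg hx, ENNReal.ofReal_of_nonpos (neg_nonpos.2 hx), add_zero]
    · rw [abs_of_nonpos hx, ENNReal.ofReal_of_nonpos hx, zero_add]
  simp only [HasFiniteIntegral, he]
  rw [lintegral_add_left (by fun_prop)]
  exact ENNReal.add_lt_top.2 ⟨h1.lt_top, h2.lt_top⟩

theorem lowerBound_iff_of_integrable (hf : Integrable f P) :
    LowerBound P f c ↔ c ≤ ∫ ω, f ω ∂P := by
  have h1 : ∫⁻ ω, ENNReal.ofReal (f ω) ∂P ≠ ⊤ := hf.lintegral_lt_top.ne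
  have h2 : ∫⁻ ω, ENNReal.ofReal (-f ω) ∂P ≠ ⊤ := hf.neg.lintegral_lt_top.ne
  rw [LowerBound, integral_eq_lintegral_pos_part_sub_lintegral_neg_part hf,
    ← ENNReal.toReal_le_toReal (by finiteness) (by finiteness),
    ENNReal.toReal_add (by finiteness) h2, ENNReal.toReal_add h1 (by finiteness),
    ENNReal.toReal_ofReal', ENNReal.toReal_ofReal']
  have := max_zero_sub_max_neg_zero_eq_self c
  constructor <;> intro h <;> linarith

/-- The inequality bounds the negative part by the positive part plus a finite constant, so
finiteness of the positive part suffices. -/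
theorem LowerBound.integrable (h : LowerBound P f c) (hf : Measurable f)
    (h1 : ∫⁻ ω, ENNReal.ofReal (f ω) ∂P ≠ ⊤) : Integrable f P := by
  refine integrable_of_lintegral_ofReal hf h1 (ne_top_of_le_ne_top ?_ (le_add_self.trans h))
  finiteness

theorem lowerBound_of_eq_top (h1 : ∫⁻ ω, ENNReal.ofReal (f ω) ∂P = ⊤) : LowerBound P f c := by
  rw [LowerBound, h1, top_add]
  exact le_top

theorem LowerBound.mono {c' : ℝ} (h : LowerBound P f c) (hf : Measurable f) (hc : c' ≤ c) :
    LowerBound P f c' := by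
  by_cases h1 : ∫⁻ ω, ENNReal.ofReal (f ω) ∂P = ⊤
  · exact lowerBound_of_eq_top h1
  · have hi := h.integrable hf h1
    rw [lowerBound_iff_of_integrable hi] at h ⊢
    exact hc.trans h

/-- If the positive part of the sum has infinite integral, there is nothing to prove. Otherwise `f⁺
≤ (g + f)⁺ + g⁻` makes the positive part of `f` finite, hence `f` integrable, and integrals add. -/
theorem LowerBound.integrable_add (h : LowerBound P f c) (hf : Measurable f)
    (hg : Integrable g P) : LowerBound P (fun ω => g ω + f ω) ((∫ ω, g ω ∂P) + c) := by
  by_cases h1 : ∫⁻ ω, ENNReal.ofReal (g ω + f ω) ∂P = ⊤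
  · exact lowerBound_of_eq_top h1
  · have h2 : ∫⁻ ω, ENNReal.ofReal (f ω) ∂P ≠ ⊤ := by
      have hle : ∫⁻ ω, ENNReal.ofReal (f ω) ∂P ≤
          ∫⁻ ω, ENNReal.ofReal (g ω + f ω) ∂P + ∫⁻ ω, ENNReal.ofReal (-g ω) ∂P := by
        have hm : AEMeasurable (fun ω => ENNReal.ofReal (-g ω)) P :=
          hg.1.aemeasurable.neg.ennreal_ofReal
        rw [← lintegral_add_right' _ hm]
        refine lintegral_mono fun ω => ?_
        refine le_trans (le_of_eq ?_) ENNReal.ofReal_add_le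
        congr 1; ring
      exact ne_top_of_le_ne_top
        (ENNReal.add_ne_top.2 ⟨h1, hg.neg.lintegral_lt_top.ne⟩) hle
    have hi := h.integrable hf h2
    rw [lowerBound_iff_of_integrable hi] at h
    have hgi : Integrable (fun ω => g ω + f ω) P := hg.add hi
    rw [lowerBound_iff_of_integrable hgi, integral_add hg hi]
    exact add_le_add_right h _

/-- A mixture of laws inherits the mixture of the lower bounds. -/
theorem LowerBound.mixture {Y Ω' : Type} [MeasurableSpace Y] [MeasurableSpace Ω'] {ρ : Measure Y}
    {κ : Y → Measure Ω'} {f' : Ω' → ℝ} {W : Y → ℝ}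
    (h1 : ∫⁻ ω, ENNReal.ofReal (f ω) ∂P = ∫⁻ y, ∫⁻ ω, ENNReal.ofReal (f' ω) ∂(κ y) ∂ρ)
    (h2 : ∫⁻ ω, ENNReal.ofReal (-f ω) ∂P = ∫⁻ y, ∫⁻ ω, ENNReal.ofReal (-f' ω) ∂(κ y) ∂ρ)
    (hW : Integrable W ρ) (hk : ∀ᵐ y ∂ρ, LowerBound (κ y) f' (W y)) :
    LowerBound P f (∫ y, W y ∂ρ) := by
  -- The inequalities are integrated in `[0, ∞]`, so `f` need not be integrable. If `f⁺` has finite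
  -- integral, every term is finite and can be rearranged in the reals.
  have h3 := lintegral_mono_ae hk
  have hm : AEMeasurable (fun y => ENNReal.ofReal (-W y)) ρ :=
    hW.1.aemeasurable.neg.ennreal_ofReal
  rw [lintegral_add_left' hW.1.aemeasurable.ennreal_ofReal, lintegral_add_right' _ hm, ← h1, ← h2] at h3
  by_cases h4 : ∫⁻ ω, ENNReal.ofReal (f ω) ∂P = ⊤
  · exact lowerBound_of_eq_top h4
  · have w1 : ∫⁻ y, ENNReal.ofReal (W y) ∂ρ ≠ ⊤ := hW.lintegral_lt_top.ne
    have w2 : ∫⁻ y, ENNReal.ofReal (-W y) ∂ρ ≠ ⊤ := hW.neg.lintegral_lt_top.ne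
    have h5 : ∫⁻ ω, ENNReal.ofReal (-f ω) ∂P ≠ ⊤ :=
      ne_top_of_le_ne_top (ENNReal.add_ne_top.2 ⟨h4, w2⟩) (le_add_self.trans h3)
    rw [← ENNReal.toReal_le_toReal (by finiteness) (by finiteness), ENNReal.toReal_add w1 h5,
      ENNReal.toReal_add h4 w2] at h3
    rw [LowerBound, ← ENNReal.toReal_le_toReal (by finiteness) (by finiteness),
      ENNReal.toReal_add (by finiteness) h5, ENNReal.toReal_add h4 (by finiteness),
      ENNReal.toReal_ofReal', ENNReal.toReal_ofReal']
    have h6 := integral_eq_lintegral_pos_part_sub_lintegral_neg_part hW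
    have := max_zero_sub_max_neg_zero_eq_self (∫ y, W y ∂ρ)
    linarith

theorem expectation_of_integrable (hf : Integrable f P) :
    expectation P f = ((∫ ω, f ω ∂P : ℝ) : EReal) := by
  have h1 : ∫⁻ ω, ENNReal.ofReal (f ω) ∂P ≠ ⊤ := hf.lintegral_lt_top.ne
  have h2 : ∫⁻ ω, ENNReal.ofReal (-f ω) ∂P ≠ ⊤ := hf.neg.lintegral_lt_top.ne
  rw [expectation, integral_eq_lintegral_pos_part_sub_lintegral_neg_part hf, EReal.coe_sub,
    EReal.coe_ennreal_toReal h1, EReal.coe_ennreal_toReal h2]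

/-- When the positive part is infinite, `HasExpectation` excludes `⊤ - ⊤`, which is `⊥` in `EReal`,
and the expectation is `⊤`. -/
theorem LowerBound.le_expectation (h : LowerBound P f c) (hf : Measurable f)
    (he : HasExpectation P f) : (c : EReal) ≤ expectation P f := by
  by_cases h1 : ∫⁻ ω, ENNReal.ofReal (f ω) ∂P = ⊤
  · have h2 : ∫⁻ ω, ENNReal.ofReal (-f ω) ∂P ≠ ⊤ := he.resolve_left (not_not.2 h1)
    rw [expectation, h1]
    lift (∫⁻ ω, ENNReal.ofReal (-f ω) ∂P) to NNReal using h2 with r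
    rw [EReal.coe_ennreal_top, EReal.top_sub (by simp)]
    exact le_top
  · have hi := h.integrable hf h1
    rw [lowerBound_iff_of_integrable hi] at h
    rw [expectation_of_integrable hi]
    exact_mod_cast h

end LowerBound

end LQG

namespace LQG

/-! ### One stage of play -/

/-- The product is built in the order `0, 1`; Tonelli's theorem lets either player be the outer one,
so later arguments treat both players at once. -/
theorem lintegral_prod_map_piFinTwo {d : Fin 2 → ℕ} (P : ∀ j, Measure (Fin (d j) → ℝ))
    [∀ j, SFinite (P j)] (i : Fin 2) {f : Joint d → ℝ≥0∞} (hf : Measurable f) :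
    ∫⁻ u, f u ∂(((P 0).prod (P 1)).map (MeasurableEquiv.piFinTwo fun j => Fin (d j) → ℝ).symm) =
      ∫⁻ a, ∫⁻ b, f (pairUp i a b) ∂(P (opp i)) ∂(P i) := by
  have e0 : ∀ (a : Fin (d 0) → ℝ) (b : Fin (d 1) → ℝ),
      (MeasurableEquiv.piFinTwo fun j => Fin (d j) → ℝ).symm (a, b) = pairUp 0 a b := fun a b =>
    joint_ext 0 (pairUp_self (d := d) 0 a b).symm (pairUp_opp (d := d) 0 a b).symm
  have e1 : ∀ (a : Fin (d 0) → ℝ) (b : Fin (d 1) → ℝ),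
      (MeasurableEquiv.piFinTwo fun j => Fin (d j) → ℝ).symm (a, b) = pairUp 1 b a := fun a b =>
    joint_ext 1 (pairUp_self (d := d) 1 b a).symm (pairUp_opp (d := d) 1 b a).symm
  rw [lintegral_map hf (MeasurableEquiv.measurable _)]
  have hf' : Measurable fun p : (Fin (d 0) → ℝ) × (Fin (d 1) → ℝ) =>
      f ((MeasurableEquiv.piFinTwo fun j => Fin (d j) → ℝ).symm p) :=
    hf.comp (MeasurableEquiv.measurable _)
  fin_cases i
  · rw [lintegral_prod _ hf'.aemeasurable]
    simp only [e0]
    rfl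
  · rw [lintegral_prod_symm _ hf'.aemeasurable]
    simp only [e1]
    rfl

theorem pi_eq_map_piFinTwo {d : Fin 2 → ℕ} (P : ∀ j, Measure (Fin (d j) → ℝ))
    [∀ j, SigmaFinite (P j)] :
    Measure.pi P =
      ((P 0).prod (P 1)).map (MeasurableEquiv.piFinTwo fun j => Fin (d j) → ℝ).symm :=
  ((measurePreserving_piFinTwo P).symm _).map_eq.symm

variable {n m : Fin 2 → ℕ}

theorem actionKernel_apply (g : Profile n m) (hg : ∀ j s, IsMarkovKernel (g j s)) (t : ℕ)
    (h : Hist n m t) :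
    actionKernel g t h = ((g 0 t (h.priv 0)).prod (g 1 t (h.priv 1))).map
      (MeasurableEquiv.piFinTwo fun j => Fin (m j) → ℝ).symm := by
  have h0 := hg 0 t
  have h1 := hg 1 t
  have hm : ∀ i, IsMarkovKernel (Kernel.id.map (Hist.priv (n := n) (m := m) (t := t) i)) :=
    fun i => Kernel.IsMarkovKernel.map _ (Game.measurable_priv i t)
  have hm0 := hm 0
  have hm1 := hm 1
  have e : ∀ i, (g i t ∘ₖ Kernel.id.map (Hist.priv i)) h = g i t (h.priv i) := fun i => by
    rw [Kernel.comp_apply, Kernel.map_apply _ (Game.measurable_priv i t), Kernel.id_apply,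
      Measure.map_dirac' (Game.measurable_priv i t), Measure.dirac_bind (Kernel.measurable _)]
  rw [actionKernel, Kernel.map_apply _ (MeasurableEquiv.measurable _), Kernel.prod_apply, e, e]

theorem isMarkovKernel_actionKernel (g : Profile n m) (hg : ∀ j s, IsMarkovKernel (g j s))
    (t : ℕ) : IsMarkovKernel (actionKernel g t) := by
  refine ⟨fun h => ?_⟩
  have h0 := hg 0 t
  have h1 := hg 1 t
  rw [actionKernel_apply g hg]
  exact Measure.isProbabilityMeasure_map (MeasurableEquiv.measurable _).aemeasurable

namespace Game

variable (G : Game n m) (θ : GenFun n m)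

/-- A complete history, prolonged by an action profile and the transition with given noises. -/
def extend (t : ℕ) (h : Hist n m t) (u : Joint m) (w : Joint n) : Hist n m (t + 1) :=
  (Fin.snoc (α := fun _ => Joint m) h.1 u,
    Fin.snoc (α := fun _ => Joint n) h.2 fun j => G.nextType t j (h.2 (Fin.last t) j) u (w j))

@[fun_prop]
theorem measurable_extend (t : ℕ) {X : Type*} [MeasurableSpace X] {h : X → Hist n m t}
    {u : X → Joint m} {w : X → Joint n} (hh : Measurable h) (hu : Measurable u)
    (hw : Measurable w) : Measurable fun x => G.extend t (h x) (u x) (w x) := by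
  refine Measurable.prodMk (measurable_snoc (by fun_prop) hu) (measurable_snoc (by fun_prop) ?_)
  refine measurable_pi_lambda _ fun j => ?_
  exact G.measurable_nextType t j (by fun_prop) hu (by fun_prop)

theorem step_apply (g : Profile n m) (hg : ∀ j s, IsMarkovKernel (g j s)) (t : ℕ)
    (h : Hist n m t) :
    G.step g t h = ((actionKernel g t h).prod
      (Measure.pi fun j => gauss (0 : Fin (n j) → ℝ) (G.Q j))).map
        fun p => G.extend t h p.1 p.2 := by
  have := isMarkovKernel_actionKernel g hg t
  have hm : Measurable fun p : (Hist n m t × Joint m) × Joint n =>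
      G.extend t p.1.1 p.1.2 p.2 := by fun_prop
  have e : G.step g t = ((Kernel.id ×ₖ actionKernel g t) ×ₖ
      Kernel.const (Hist n m t) (Measure.pi fun j => gauss (0 : Fin (n j) → ℝ) (G.Q j))).map
        fun p => G.extend t p.1.1 p.1.2 p.2 := rfl
  rw [e, Kernel.map_apply _ hm, Kernel.prod_apply, Kernel.prod_apply, Kernel.id_apply,
    Kernel.const_apply, Measure.dirac_prod]
  conv_lhs => rw [← Measure.map_id
    (μ := Measure.pi fun j => gauss (0 : Fin (n j) → ℝ) (G.Q j))]
  rw [Measure.map_prod_map _ _ (by fun_prop) measurable_id, Measure.map_map hm (by fun_prop)]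
  rfl

theorem isMarkovKernel_step (g : Profile n m) (hg : ∀ j s, IsMarkovKernel (g j s)) (t : ℕ) :
    IsMarkovKernel (G.step g t) := by
  refine ⟨fun h => ?_⟩
  have := isMarkovKernel_actionKernel g hg t
  rw [G.step_apply g hg]
  exact Measure.isProbabilityMeasure_map (by fun_prop)

theorem lintegral_step (g : Profile n m) (hg : ∀ j s, IsMarkovKernel (g j s)) (i : Fin 2) (t : ℕ)
    (h : Hist n m t) {f : Hist n m (t + 1) → ℝ≥0∞} (hf : Measurable f) :
    ∫⁻ x, f x ∂(G.step g t h) =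
      ∫⁻ a, ∫⁻ b, ∫⁻ w, ∫⁻ v, f (G.extend t h (pairUp i a b) (pairUp i w v))
        ∂(gauss (0 : Fin (n (opp i)) → ℝ) (G.Q (opp i))) ∂(gauss (0 : Fin (n i) → ℝ) (G.Q i))
        ∂(g (opp i) t (h.priv (opp i))) ∂(g i t (h.priv i)) := by
  have := isMarkovKernel_actionKernel g hg t
  have hm : Measurable fun p : Joint m × Joint n => f (G.extend t h p.1 p.2) :=
    hf.comp (by fun_prop)
  rw [G.step_apply g hg, lintegral_map hf (by fun_prop), lintegral_prod _ hm.aemeasurable,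
    actionKernel_apply g hg,
    lintegral_prod_map_piFinTwo (fun j => g j t (h.priv j)) i hm.lintegral_prod_right']
  refine lintegral_congr fun a => lintegral_congr fun b => ?_
  rw [pi_eq_map_piFinTwo, lintegral_prod_map_piFinTwo (fun j => gauss (0 : Fin (n j) → ℝ) (G.Q j)) i]
  exact hm.comp (by fun_prop)

/-- The first stage of the evolution can be split off. -/
theorem lintegral_evolve_succ (g : Profile n m) (t k : ℕ)
    (f : ∀ s, Hist n m s → ℝ≥0∞) (hf : ∀ s, Measurable (f s)) (h : Hist n m t) :
    ∫⁻ x, f (t + (k + 1)) x ∂(G.evolve g t (k + 1) h) =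
      ∫⁻ y, ∫⁻ x, f (t + 1 + k) x ∂(G.evolve g (t + 1) k y) ∂(G.step g t h) := by
  -- `t + (k + 1)` and `t + 1 + k` are not definitionally equal, so the two sides integrate over
  -- different history types; a family of functions over all stages avoids casts. The induction
  -- hypothesis is used for the family integrated over one further step.
  induction k generalizing f with
  | zero =>
    have e1 : G.evolve g t (0 + 1) h = G.step g t h := by
      change (G.step g (t + 0) ∘ₖ Kernel.id) h = _
      rw [Kernel.comp_id]
      rfl
    rw [e1]
    refine lintegral_congr fun y => ?_
    exact (lintegral_dirac' y (hf (t + 1))).symm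
  | succ k ih =>
    have hm : ∀ s, Measurable fun y => ∫⁻ x, f (s + 1) x ∂(G.step g s y) := fun s =>
      (hf (s + 1)).lintegral_kernel
    have h1 := ih (fun s y => ∫⁻ x, f (s + 1) x ∂(G.step g s y)) hm
    have e1 : ∫⁻ x, f (t + (k + 1 + 1)) x ∂(G.evolve g t (k + 1 + 1) h) =
        ∫⁻ y, ∫⁻ x, f (t + (k + 1) + 1) x ∂(G.step g (t + (k + 1)) y)
          ∂(G.evolve g t (k + 1) h) :=
      Kernel.lintegral_comp _ _ _ (hf _)
    rw [e1, h1]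
    refine lintegral_congr fun y => ?_
    exact (Kernel.lintegral_comp (G.step g (t + 1 + k)) (G.evolve g (t + 1) k) y
      (hf (t + 1 + k + 1))).symm

/-! ### Costs along a history -/

/-- The cost of player `i` at stage `t` along a complete history. -/
def costAt (i : Fin 2) (t : ℕ) {s : ℕ} (h : Hist n m s) : ℝ :=
  ∑ k : Fin s, if (k : ℕ) = t then G.stageCost i (h.2 k.castSucc) (h.1 k) else 0

theorem costFrom_eq_add (i : Fin 2) (t : ℕ) {s : ℕ} (h : Hist n m s) :
    G.costFrom i t h = G.costAt i t h + G.costFrom i (t + 1) h := by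
  rw [costFrom, costAt, costFrom, ← Finset.sum_add_distrib]
  refine Finset.sum_congr rfl fun k _ => ?_
  rcases lt_trichotomy (k : ℕ) t with h | h | h
  · rw [if_neg (by omega), if_neg (by omega), if_neg (by omega), add_zero]
  · rw [if_pos (by omega), if_pos (by omega), if_neg (by omega), add_zero]
  · rw [if_pos (by omega), if_neg (by omega), if_pos (by omega), zero_add]

theorem costFrom_eq_zero (i : Fin 2) {t s : ℕ} (hs : s ≤ t) (h : Hist n m s) :
    G.costFrom i t h = 0 :=
  Finset.sum_eq_zero fun k _ => if_neg (by omega)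

theorem costAt_extend_of_lt (i : Fin 2) {t s : ℕ} (hs : t < s) (h : Hist n m s) (u : Joint m)
    (w : Joint n) : G.costAt i t (G.extend s h u w) = G.costAt i t h := by
  rw [costAt, Fin.sum_univ_castSucc, Fin.val_last, if_neg (by omega), add_zero, costAt]
  refine Finset.sum_congr rfl fun k _ => ?_
  simp only [extend, Fin.snoc_castSucc, Fin.val_castSucc]

theorem costAt_extend (i : Fin 2) (t : ℕ) (h : Hist n m t) (u : Joint m) (w : Joint n) :
    G.costAt i t (G.extend t h u w) = G.stageCost i (h.2 (Fin.last t)) u := by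
  rw [costAt, Fin.sum_univ_castSucc, Fin.val_last, if_pos rfl, Finset.sum_eq_zero, zero_add]
  · simp only [extend, Fin.snoc_last, Fin.snoc_castSucc]
  · intro k _
    exact if_neg (by simp only [Fin.val_castSucc]; omega)

theorem continuous_stageCost (i : Fin 2) :
    Continuous fun p : Joint n × Joint m => G.stageCost i p.1 p.2 := by
  unfold stageCost
  have h1 : Continuous fun p : Joint n × Joint m => stack p.1 := by fun_prop
  have h2 : Continuous fun p : Joint n × Joint m => stack p.2 := by fun_prop
  fun_prop

theorem measurable_costAt (i : Fin 2) (t s : ℕ) :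
    Measurable fun h : Hist n m s => G.costAt i t h := by
  unfold costAt
  refine Finset.measurable_fun_sum _ fun k _ => ?_
  split_ifs
  · exact (G.continuous_stageCost i).measurable.comp (f := fun h : Hist n m s =>
      (h.2 k.castSucc, h.1 k)) (by fun_prop)
  · exact measurable_const

theorem measurable_costFrom (i : Fin 2) (t s : ℕ) :
    Measurable fun h : Hist n m s => G.costFrom i t h := by
  unfold costFrom
  refine Finset.measurable_fun_sum _ fun k _ => ?_
  split_ifs
  · exact (G.continuous_stageCost i).measurable.comp (f := fun h : Hist n m s =>
      (h.2 k.castSucc, h.1 k)) (by fun_prop)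
  · exact measurable_const

/-- Later play does not change the cost of a past stage. -/
theorem map_costAt_evolve (g : Profile n m) (hg : ∀ j s, IsMarkovKernel (g j s)) (i : Fin 2)
    (t k : ℕ) (P : Measure (Hist n m (t + 1))) :
    (P.bind (G.evolve g (t + 1) k)).map (G.costAt i t) = P.map (G.costAt i t) := by
  induction k with
  | zero =>
    change (P.bind Kernel.id).map _ = _
    rw [Measure.id_comp]
  | succ k ih =>
    have hs := G.isMarkovKernel_step g hg (t + 1 + k)
    rw [← ih]
    change (P.bind (G.step g (t + 1 + k) ∘ₖ G.evolve g (t + 1) k)).map _ = _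
    rw [← Measure.comp_assoc]
    refine Measure.ext_of_lintegral _ fun f hf => ?_
    have hf' : ∀ s, Measurable fun x : Hist n m s => f (G.costAt i t x) :=
      fun s => hf.comp (G.measurable_costAt i t s)
    rw [lintegral_map hf (G.measurable_costAt i t _), lintegral_map hf (G.measurable_costAt i t _)]
    refine (Measure.lintegral_bind (Kernel.aemeasurable _) (hf' _).aemeasurable).trans ?_
    refine lintegral_congr fun y => ?_
    rw [G.step_apply g hg, lintegral_map (hf' _) (by fun_prop)]
    have := isMarkovKernel_actionKernel g hg (t + 1 + k)
    simp only [G.costAt_extend_of_lt i (show t < t + 1 + k by omega), lintegral_const, measure_univ,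
      mul_one]

end Game

end LQG

/-! ### One stage of play in the belief of one player -/

namespace LQG

variable {n m : Fin 2 → ℕ}

namespace Game

variable (G : Game n m) (θ : GenFun n m) (i : Fin 2) (t : ℕ)

/-- The action profile when player `i` plays `a`, the other player follows the equilibrium, and the
types of the other player deviate by `z` from their mean in the common belief. -/
def playAction (u : PubHist m t) (a : Fin (m i) → ℝ) (z : TypeHist n (opp i) t) : Joint m :=
  pairUp i a (G.action θ (opp i) t (u, G.histMean θ (opp i) t u + z))

/-- The next private history of player `i`. -/
def nextPriv (h : PrivHist n m i t) (u : Joint m) (w : Fin (n i) → ℝ) : PrivHist n m i (t + 1) :=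
  (Fin.snoc (α := fun _ => Joint m) h.1 u,
    Fin.snoc (α := fun _ => Fin (n i) → ℝ) h.2 (G.nextType t i (h.2 (Fin.last t)) u w))

/-- The next complete history, in the belief of player `i`, as a function of the noises. -/
def nextHist (h : PrivHist n m i t) (a : Fin (m i) → ℝ)
    (p : TypeHist n (opp i) t × (Fin (n i) → ℝ) × (Fin (n (opp i)) → ℝ)) : Hist n m (t + 1) :=
  G.extend t (combine i h (G.histMean θ (opp i) t h.1 + p.1)) (G.playAction θ i t h.1 a p.1)
    (pairUp i p.2.1 p.2.2)

/-- The law of the next complete history in the belief of player `i`, when playing `a`. -/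
def playLaw (h : PrivHist n m i t) (a : Fin (m i) → ℝ) : Measure (Hist n m (t + 1)) :=
  ((G.noiseLaw θ (opp i) t).prod ((gauss (0 : Fin (n i) → ℝ) (G.Q i)).prod
    (gauss (0 : Fin (n (opp i)) → ℝ) (G.Q (opp i))))).map (G.nextHist θ i t h a)

@[fun_prop]
theorem measurable_playAction {X : Type*} [MeasurableSpace X] {u : X → PubHist m t}
    {a : X → Fin (m i) → ℝ} {z : X → TypeHist n (opp i) t} (hu : Measurable u) (ha : Measurable a)
    (hz : Measurable z) : Measurable fun x => G.playAction θ i t (u x) (a x) (z x) := by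
  refine measurable_pairUp i ha ?_
  exact (G.measurable_action θ (opp i) t).comp
    (hu.prodMk (((G.measurable_histMean θ (opp i) t).comp hu).add hz))

@[fun_prop]
theorem measurable_nextPriv {X : Type*} [MeasurableSpace X] {h : X → PrivHist n m i t}
    {u : X → Joint m} {w : X → Fin (n i) → ℝ} (hh : Measurable h) (hu : Measurable u)
    (hw : Measurable w) : Measurable fun x => G.nextPriv i t (h x) (u x) (w x) :=
  (measurable_snoc (by fun_prop) hu).prodMk
    (measurable_snoc (by fun_prop) (G.measurable_nextType t i (by fun_prop) hu hw))

@[fun_prop]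
theorem measurable_nextHist {X : Type*} [MeasurableSpace X] {h : X → PrivHist n m i t}
    {a : X → Fin (m i) → ℝ}
    {p : X → TypeHist n (opp i) t × (Fin (n i) → ℝ) × (Fin (n (opp i)) → ℝ)} (hh : Measurable h)
    (ha : Measurable a) (hp : Measurable p) :
    Measurable fun x => G.nextHist θ i t (h x) (a x) (p x) := by
  have hm : Measurable fun x => G.histMean θ (opp i) t (h x).1 + (p x).1 :=
    ((G.measurable_histMean θ (opp i) t).comp hh.fst).add hp.fst
  exact G.measurable_extend t (measurable_combine i hh hm)
    (G.measurable_playAction θ i t hh.fst ha hp.fst)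
    (measurable_pairUp i hp.snd.fst hp.snd.snd)

theorem lintegral_playLaw (h : PrivHist n m i t) (a : Fin (m i) → ℝ)
    {f : Hist n m (t + 1) → ℝ≥0∞} (hf : Measurable f) :
    ∫⁻ x, f x ∂(G.playLaw θ i t h a) =
      ∫⁻ z, ∫⁻ w, ∫⁻ v, f (G.nextHist θ i t h a (z, w, v))
        ∂(gauss (0 : Fin (n (opp i)) → ℝ) (G.Q (opp i))) ∂(gauss (0 : Fin (n i) → ℝ) (G.Q i))
        ∂(G.noiseLaw θ (opp i) t) := by
  have h1 : Measurable fun p => f (G.nextHist θ i t h a p) := hf.comp (by fun_prop)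
  rw [playLaw, lintegral_map hf (by fun_prop), lintegral_prod _ h1.aemeasurable]
  refine lintegral_congr fun z => ?_
  have h2 : Measurable fun q => f (G.nextHist θ i t h a (z, q)) := hf.comp (by fun_prop)
  rw [lintegral_prod _ h2.aemeasurable]

/-- One stage of play against the equilibrium strategy, in the belief of player `i`. -/
theorem lintegral_beliefs_bind_step (g : Profile n m) (hg : ∀ j s, IsMarkovKernel (g j s))
    (ho : g (opp i) t = G.betaStar θ (opp i) t) (h : PrivHist n m i t)
    {f : Hist n m (t + 1) → ℝ≥0∞} (hf : Measurable f) :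
    ∫⁻ x, f x ∂((G.beliefs θ i t h).bind (G.step g t)) =
      ∫⁻ a, ∫⁻ x, f x ∂(G.playLaw θ i t h a) ∂(g i t h) := by
  have hgi := hg i t
  have h1 : Measurable fun y => ∫⁻ x, f x ∂(G.step g t y) := hf.lintegral_kernel
  have h2 : ∀ z, Hist.priv i (combine i h (G.histMean θ (opp i) t h.1 + z)) = h := fun z =>
    Prod.ext rfl (funext fun k => pairUp_self i _ _)
  have h3 : ∀ z, Hist.priv (opp i) (combine i h (G.histMean θ (opp i) t h.1 + z)) =
      (h.1, G.histMean θ (opp i) t h.1 + z) := fun z =>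
    Prod.ext rfl (funext fun k => pairUp_opp i _ _)
  have h4 : Measurable fun q : ((TypeHist n (opp i) t × (Fin (m i) → ℝ)) × (Fin (n i) → ℝ)) ×
      (Fin (n (opp i)) → ℝ) => f (G.nextHist θ i t h q.1.1.2 (q.1.1.1, q.1.2, q.2)) :=
    hf.comp (by fun_prop)
  have h5 := h4.lintegral_prod_right' (ν := gauss (0 : Fin (n (opp i)) → ℝ) (G.Q (opp i)))
  have h6 := h5.lintegral_prod_right' (ν := gauss (0 : Fin (n i) → ℝ) (G.Q i))
  have h7 : ∀ z, Measurable fun q : (Fin (m i) → ℝ) × (Fin (m (opp i)) → ℝ) =>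
      ∫⁻ w, ∫⁻ v, f (G.extend t (combine i h (G.histMean θ (opp i) t h.1 + z))
        (pairUp i q.1 q.2) (pairUp i w v))
        ∂(gauss (0 : Fin (n (opp i)) → ℝ) (G.Q (opp i)))
        ∂(gauss (0 : Fin (n i) → ℝ) (G.Q i)) := fun z => by
    have h8 : Measurable fun q : (((Fin (m i) → ℝ) × (Fin (m (opp i)) → ℝ)) × (Fin (n i) → ℝ)) ×
        (Fin (n (opp i)) → ℝ) => f (G.extend t (combine i h (G.histMean θ (opp i) t h.1 + z))
          (pairUp i q.1.1.1 q.1.1.2) (pairUp i q.1.2 q.2)) := hf.comp (by fun_prop)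
    exact (h8.lintegral_prod_right').lintegral_prod_right'
  rw [Measure.lintegral_bind (Kernel.aemeasurable _) hf.aemeasurable, beliefs_apply,
    lintegral_map h1 (by fun_prop)]
  simp only [G.lintegral_step g hg i t _ hf, h2, h3, ho, betaStar, Kernel.deterministic_apply,
    G.lintegral_playLaw θ i t h _ hf]
  -- The other player's types are integrated outside the own action at first. The law of the own
  -- action depends only on `h`, which is known, so the order can be exchanged.
  refine Eq.trans (lintegral_congr fun z => lintegral_congr fun a => ?_)
    (lintegral_lintegral_swap h6.aemeasurable)
  exact lintegral_dirac' _ ((h7 z).comp measurable_prodMk_left)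

theorem lintegral_beliefs (h : PrivHist n m i t) {f : Hist n m t → ℝ≥0∞} (hf : Measurable f) :
    ∫⁻ x, f x ∂(G.beliefs θ i t h) =
      ∫⁻ z, f (combine i h z) ∂(G.histBelief θ (opp i) t h.1) := by
  have hc : Measurable fun z => f (combine i h z) := hf.comp (by fun_prop)
  rw [beliefs_apply, histBelief_apply, lintegral_map hf (by fun_prop),
    lintegral_map hc (by fun_prop)]

/-- After one stage of play, the belief about the types of the other player given the private
history is the common belief. -/
theorem lintegral_playLaw_eq_beliefs (h : PrivHist n m i t) (a : Fin (m i) → ℝ)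
    {f : Hist n m (t + 1) → ℝ≥0∞} (hf : Measurable f) :
    ∫⁻ x, f x ∂(G.playLaw θ i t h a) =
      ∫⁻ z, ∫⁻ w, ∫⁻ x, f x
          ∂(G.beliefs θ i (t + 1) (G.nextPriv i t h (G.playAction θ i t h.1 a z) w))
        ∂(gauss (0 : Fin (n i) → ℝ) (G.Q i)) ∂(G.noiseLaw θ (opp i) t) := by
  set u := h.1 with hu
  -- The next complete history splits into the own next private history, which sees the other
  -- player's types only through the action, and the prolonged type history of the other player.
  have e1 : ∀ z w v, G.nextHist θ i t h a (z, w, v) =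
      combine i (G.nextPriv i t h (G.playAction θ i t u a z) w)
        (Fin.snoc (α := fun _ => Fin (n (opp i)) → ℝ) (G.histMean θ (opp i) t u + z)
          (G.nextType t (opp i) ((G.histMean θ (opp i) t u + z) (Fin.last t))
            (G.playAction θ i t u a z) v)) := fun z w v => by
    refine Prod.ext rfl (funext fun k => ?_)
    refine Fin.lastCases ?_ (fun k => ?_) k
    · simp only [nextHist, extend, combine, nextPriv, Fin.snoc_last]
      refine joint_ext i ?_ ?_
      · simp only [pairUp_self]; rfl
      · simp only [pairUp_opp]; rfl
    · simp only [nextHist, extend, combine, nextPriv, Fin.snoc_castSucc]; rfl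
  -- The other player's action and type history become separate arguments, which is the form
  -- required by `lintegral_bayes`.
  set F : (Fin (n i) → ℝ) → (Fin (n (opp i)) → ℝ) →
      ((Fin (m (opp i)) → ℝ) × TypeHist n (opp i) t) → ℝ≥0∞ := fun w v p =>
    f (combine i (G.nextPriv i t h (pairUp i a p.1) w)
        (Fin.snoc (α := fun _ => Fin (n (opp i)) → ℝ) p.2
          (G.nextType t (opp i) (p.2 (Fin.last t)) (pairUp i a p.1) v))) with hF
  have hFm : Measurable fun q : (((Fin (m (opp i)) → ℝ) × TypeHist n (opp i) t) ×
      (Fin (n i) → ℝ)) × (Fin (n (opp i)) → ℝ) => F q.1.2 q.2 q.1.1 := by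
    refine hf.comp (measurable_combine i (by fun_prop) (measurable_snoc (by fun_prop) ?_))
    exact G.measurable_nextType t _ (by fun_prop) (by fun_prop) (by fun_prop)
  have hF1 := hFm.lintegral_prod_right' (ν := gauss (0 : Fin (n (opp i)) → ℝ) (G.Q (opp i)))
  have hF2 := hF1.lintegral_prod_right' (ν := gauss (0 : Fin (n i) → ℝ) (G.Q i))
  have hb := G.lintegral_bayes θ (opp i) t u hF2
  have e2 : ∀ z w v, f (G.nextHist θ i t h a (z, w, v)) =
      F w v (G.action θ (opp i) t (u, G.histMean θ (opp i) t u + z),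
        G.histMean θ (opp i) t u + z) := fun z w v => by
    rw [e1]; rfl
  rw [G.lintegral_playLaw θ i t h a hf]
  simp only [e2]
  -- From here on `z` determines the observed action only, and the type history is drawn from the
  -- posterior with a fresh residual `z'`.
  refine hb.trans (lintegral_congr fun z => ?_)
  set b := G.action θ (opp i) t (u, G.histMean θ (opp i) t u + z) with hbd
  have hpost : Measurable fun z' : TypeHist n (opp i) t =>
      G.postMean θ (opp i) t (G.histMean θ (opp i) t u) u b +
        resid (G.noiseLaw θ (opp i) t) (θ.L t (G.cov θ t) (opp i)) z' := by fun_prop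
  -- The own noise is moved outside the residual, because the next private history must be fixed
  -- before its belief is integrated.
  rw [lintegral_lintegral_swap]
  · refine lintegral_congr fun w => ?_
    have hs : Measurable fun p : TypeHist n (opp i) t × (Fin (n (opp i)) → ℝ) =>
        (Fin.snoc (α := fun _ => Fin (n (opp i)) → ℝ) p.1
          (G.nextType t (opp i) (p.1 (Fin.last t)) (pairUp i a b) p.2) :
            TypeHist n (opp i) (t + 1)) :=
      measurable_snoc measurable_fst
        (G.measurable_nextType t _ (by fun_prop) measurable_const measurable_snd)
    have hc : Measurable fun x : TypeHist n (opp i) (t + 1) =>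
        f (combine i (G.nextPriv i t h (pairUp i a b) w) x) := hf.comp (by fun_prop)
    have e3 : G.playAction θ i t u a z = pairUp i a b := rfl
    rw [e3, G.lintegral_beliefs θ i (t + 1) _ hf]
    have e4 : (G.nextPriv i t h (pairUp i a b) w).1 =
      Fin.snoc (α := fun _ => Joint m) u (pairUp i a b) := rfl
    have hcs : Measurable fun p : TypeHist n (opp i) t × (Fin (n (opp i)) → ℝ) =>
        F w p.2 (b, p.1) := hc.comp hs
    rw [e4, histBelief_succ, lintegral_map hc hs, pairUp_opp]
    refine Eq.trans ?_ (lintegral_prod _ hcs.aemeasurable).symm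
    rw [histPost_apply, lintegral_map hcs.lintegral_prod_right' hpost]
  · have hq : Measurable fun q : TypeHist n (opp i) t × (Fin (n i) → ℝ) =>
        ((b, G.postMean θ (opp i) t (G.histMean θ (opp i) t u) u b +
          resid (G.noiseLaw θ (opp i) t) (θ.L t (G.cov θ t) (opp i)) q.1), q.2) :=
      (measurable_const.prodMk (hpost.comp measurable_fst)).prodMk measurable_snd
    exact (hF1.comp hq).aemeasurable

end Game

end LQG

namespace LQG

/-! ### Sums over the coordinates of a pair of vectors -/

theorem sum_eq_add_opp {M : Type*} [AddCommMonoid M] (i : Fin 2) (f : Fin 2 → M) :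
    ∑ j, f j = f i + f (opp i) := by
  rw [Fin.sum_univ_two]
  fin_cases i
  · rfl
  · exact add_comm _ _

theorem sum_sigma_selfFirst {M : Type*} [AddCommMonoid M] {d : Fin 2 → ℕ} (i : Fin 2)
    (f : (Σ j, Fin (d j)) → M) : ∑ p, f p = ∑ q, f (selfFirst d i q) := by
  rw [Fintype.sum_sigma, sum_eq_add_opp i, Fintype.sum_sum_type]
  rfl

theorem stack_selfFirst {d : Fin 2 → ℕ} (i : Fin 2) (v : Joint d) :
    stack v ∘ selfFirst d i = Sum.elim (v i) (v (opp i)) := by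
  funext q
  cases q <;> rfl

theorem mulVec_stack_selfFirst {d : Fin 2 → ℕ} {r r' : Type} (i : Fin 2)
    (M : Matrix r (Σ j, Fin (d j)) ℝ) (v : Joint d) (f : r' → r) :
    (M *ᵥ stack v) ∘ f = M.submatrix f (selfFirst d i) *ᵥ Sum.elim (v i) (v (opp i)) := by
  funext a
  rw [← stack_selfFirst]
  exact sum_sigma_selfFirst i _

theorem stack_dotProduct {d : Fin 2 → ℕ} (i : Fin 2) (v : Joint d) (w : (Σ j, Fin (d j)) → ℝ) :
    stack v ⬝ᵥ w = Sum.elim (v i) (v (opp i)) ⬝ᵥ (w ∘ selfFirst d i) := by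
  rw [← stack_selfFirst]
  exact sum_sigma_selfFirst i _

/-! ### Quadratic forms -/

section Quad

variable {a b : Type} [Fintype a]

/-- The quadratic form of a matrix. -/
def quad (V : Matrix a a ℝ) (v : a → ℝ) : ℝ := v ⬝ᵥ (V *ᵥ v)

theorem quad_add {V : Matrix a a ℝ} (hV : V.IsSymm) (v w : a → ℝ) :
    quad V (v + w) = quad V v + 2 * (w ⬝ᵥ (V *ᵥ v)) + quad V w := by
  have h : v ⬝ᵥ (V *ᵥ w) = w ⬝ᵥ (V *ᵥ v) := by
    rw [Matrix.dotProduct_mulVec, ← Matrix.mulVec_transpose, hV.eq, dotProduct_comm]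
  simp only [quad, Matrix.mulVec_add, dotProduct_add, add_dotProduct, h]
  ring

theorem quad_mulVec [Fintype b] (V : Matrix a a ℝ) (F : Matrix a b ℝ) (v : b → ℝ) :
    quad V (F *ᵥ v) = quad (Fᵀ * V * F) v := by
  rw [quad, quad, ← Matrix.mulVec_mulVec, ← Matrix.mulVec_mulVec, Matrix.dotProduct_mulVec v Fᵀ,
    Matrix.vecMul_transpose]

theorem quad_eq_sum (V : Matrix a a ℝ) (v : a → ℝ) :
    quad V v = ∑ k, ∑ l, V k l * (v k * v l) := by
  simp only [quad, dotProduct, Matrix.mulVec, Finset.mul_sum]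
  exact Finset.sum_congr rfl fun k _ => Finset.sum_congr rfl fun l _ => by ring

theorem integrable_quad {Ω : Type} [MeasurableSpace Ω] {P : Measure Ω} {X : Ω → a → ℝ}
    (hX : SqIntegrable X P) (V : Matrix a a ℝ) : Integrable (fun ω => quad V (X ω)) P := by
  simp only [quad_eq_sum]
  refine integrable_finsetSum _ fun k _ => integrable_finsetSum _ fun l _ => ?_
  exact ((hX k).integrable_mul (hX l)).const_mul _

/-- The mean of a quadratic form of a random vector with a given mean. -/
theorem integral_quad_const_add {Ω : Type} [MeasurableSpace Ω] {P : Measure Ω}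
    [IsProbabilityMeasure P] {X : Ω → a → ℝ} (hX : SqIntegrable X P) (h0 : ∀ k, ∫ ω, X ω k ∂P = 0)
    {V : Matrix a a ℝ} (hV : V.IsSymm) (v : a → ℝ) :
    ∫ ω, quad V (v + X ω) ∂P = quad V v + ∫ ω, quad V (X ω) ∂P := by
  have hi : ∀ k, Integrable (fun ω => X ω k * (V *ᵥ v) k) P := fun k =>
    ((hX k).integrable (by norm_num)).mul_const _
  have h1 : Integrable (fun ω => X ω ⬝ᵥ (V *ᵥ v)) P := integrable_finsetSum _ fun k _ => hi k
  have h2 : ∫ ω, X ω ⬝ᵥ (V *ᵥ v) ∂P = 0 := by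
    simp only [dotProduct]
    rw [integral_finsetSum _ fun k _ => hi k]
    simp only [integral_mul_const, h0, zero_mul, Finset.sum_const_zero]
  have h3 : Integrable (fun ω => quad V v + 2 * (X ω ⬝ᵥ (V *ᵥ v))) P :=
    (integrable_const _).add (h1.const_mul 2)
  simp only [quad_add hV]
  rw [integral_add h3 (integrable_quad hX V), integral_add (integrable_const _) (h1.const_mul 2),
    integral_const_mul, h2]
  simp

theorem integral_mulVec_eq_zero {Ω : Type} [MeasurableSpace Ω] {P : Measure Ω}
    [IsProbabilityMeasure P] {X : Ω → a → ℝ} (hX : SqIntegrable X P) (h0 : ∀ k, ∫ ω, X ω k ∂P = 0)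
    (M : Matrix b a ℝ) (k : b) : ∫ ω, (M *ᵥ X ω) k ∂P = 0 := by
  simp only [Matrix.mulVec, dotProduct]
  rw [integral_finsetSum _ fun l _ => ((hX l).integrable (by norm_num)).const_mul _]
  simp only [integral_const_mul, h0, mul_zero, Finset.sum_const_zero]

end Quad

/-! ### The vector of actions, types and next means -/

variable {n m : Fin 2 → ℕ}

/-- A vector given by its seven blocks, in the order of `YIdx`. -/
def yElim {i : Fin 2} (v₁ : Fin (m i) → ℝ) (v₂ : Fin (m (opp i)) → ℝ) (v₃ : Fin (n i) → ℝ)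
    (v₄ : Fin (n (opp i)) → ℝ) (v₅ v₆ : Fin (n i) → ℝ) (v₇ : Fin (n (opp i)) → ℝ) :
    YIdx n m i → ℝ :=
  Sum.elim (Sum.elim (Sum.elim v₁ v₂) (Sum.elim v₃ v₄)) (Sum.elim v₅ (Sum.elim v₆ v₇))

theorem yElim_add {i : Fin 2} (v₁ v₁' : Fin (m i) → ℝ) (v₂ v₂' : Fin (m (opp i)) → ℝ)
    (v₃ v₃' : Fin (n i) → ℝ) (v₄ v₄' : Fin (n (opp i)) → ℝ) (v₅ v₅' v₆ v₆' : Fin (n i) → ℝ)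
    (v₇ v₇' : Fin (n (opp i)) → ℝ) :
    yElim v₁ v₂ v₃ v₄ v₅ v₆ v₇ + yElim v₁' v₂' v₃' v₄' v₅' v₆' v₇' =
      yElim (v₁ + v₁') (v₂ + v₂') (v₃ + v₃') (v₄ + v₄') (v₅ + v₅') (v₆ + v₆') (v₇ + v₇') := by
  funext q
  rcases q with ((q | q) | (q | q)) | (q | (q | q)) <;> rfl

theorem yRows_mulVec {i : Fin 2} {c : Type} [Fintype c]
    (r₁ : Matrix (Fin (m i)) c ℝ) (r₂ : Matrix (Fin (m (opp i))) c ℝ)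
    (r₃ : Matrix (Fin (n i)) c ℝ) (r₄ : Matrix (Fin (n (opp i))) c ℝ)
    (r₅ : Matrix (Fin (n i)) c ℝ) (r₆ : Matrix (Fin (n i)) c ℝ)
    (r₇ : Matrix (Fin (n (opp i))) c ℝ) (v : c → ℝ) :
    yRows r₁ r₂ r₃ r₄ r₅ r₆ r₇ *ᵥ v =
      yElim (r₁ *ᵥ v) (r₂ *ᵥ v) (r₃ *ᵥ v) (r₄ *ᵥ v) (r₅ *ᵥ v) (r₆ *ᵥ v) (r₇ *ᵥ v) := by
  funext q
  rcases q with ((q | q) | (q | q)) | (q | (q | q)) <;> rfl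

namespace Game

variable (G : Game n m) (θ : GenFun n m) (i : Fin 2) (t : ℕ)

theorem B_mulVec_stack (j : Fin 2) (u : Joint m) :
    G.B t j *ᵥ stack u = G.Bblock t j i *ᵥ u i + G.Bblock t j (opp i) *ᵥ u (opp i) := by
  have h := mulVec_stack_selfFirst i (G.B t j) u id
  rw [Function.comp_id] at h
  rw [h]
  have e : (G.B t j).submatrix id (selfFirst m i) =
      fromCols (G.Bblock t j i) (G.Bblock t j (opp i)) := by
    ext a q
    cases q <;> rfl
  rw [e, fromCols_mulVec_sumElim]

/-- The means of the common beliefs, those about player `i` first. -/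
def meanVec (u : PubHist m t) : Fin (n i) ⊕ Fin (n (opp i)) → ℝ :=
  Sum.elim (G.mean θ t u i) (G.mean θ t u (opp i))

/-- The vector `(x^i, x̂^i, x̂^{-i})` at a private history. -/
def estVec (h : PrivHist n m i t) : EIdx n i → ℝ :=
  Sum.elim (h.2 (Fin.last t)) (G.meanVec θ i t h.1)

/-- The dependence on the deviation of the other player's type of the vector `y^i`. -/
def Nz : Matrix (YIdx n m i) (Fin (n (opp i))) ℝ :=
  let L := θ.L t (G.cov θ t)
  yRows 0 (L (opp i)) 0 1 (G.Bblock t i (opp i) * L (opp i)) (G.Bblock t i (opp i) * L (opp i))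
    (G.Bblock t (opp i) (opp i) * L (opp i) +
      G.A t (opp i) * gain (G.cov θ t) L (opp i) * L (opp i))

/-- The dependence on the noise of player `i` of the vector `y^i`. -/
def Nw : Matrix (YIdx n m i) (Fin (n i)) ℝ := yRows 0 0 0 0 1 0 0

/-- The mean of the vector `y^i` at a private history when playing `a`. -/
def yMean (h : PrivHist n m i t) (a : Fin (m i) → ℝ) : YIdx n m i → ℝ :=
  let S := G.cov θ t
  G.Du t S (θ.L t S) i *ᵥ a + G.De₁ t i *ᵥ h.2 (Fin.last t) +
    G.De₂₃ t S (θ.L t S) i *ᵥ G.meanVec θ i t h.1 +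
    G.Cmat t S (θ.L t S) i *ᵥ (θ.Mboth t S i *ᵥ G.meanVec θ i t h.1)

/-- The deviation of the vector `y^i` from its mean. -/
def yNoise (p : TypeHist n (opp i) t × (Fin (n i) → ℝ)) : YIdx n m i → ℝ :=
  G.Nz θ i t *ᵥ p.1 (Fin.last t) + Nw i *ᵥ p.2

/-- The vector `y^i`. -/
def yVec (h : PrivHist n m i t) (a : Fin (m i) → ℝ)
    (p : TypeHist n (opp i) t × (Fin (n i) → ℝ)) : YIdx n m i → ℝ :=
  Sum.elim
    (Sum.elim (Sum.elim a (G.playAction θ i t h.1 a p.1 (opp i)))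
      (Sum.elim (h.2 (Fin.last t)) ((G.histMean θ (opp i) t h.1 + p.1) (Fin.last t))))
    (G.estVec θ i (t + 1) (G.nextPriv i t h (G.playAction θ i t h.1 a p.1) p.2))

theorem M_mulVec_stack_mean (j : Fin 2) (u : PubHist m t) :
    θ.M t (G.cov θ t) j *ᵥ stack (G.mean θ t u) =
      (θ.M t (G.cov θ t) j).submatrix id (selfFirst n i) *ᵥ G.meanVec θ i t u := by
  have h := mulVec_stack_selfFirst i (θ.M t (G.cov θ t) j) (G.mean θ t u) id
  rwa [Function.comp_id] at h

/-- All blocks are affine because the gains are fixed matrices. The other player's innovation is `L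
z`, of mean zero: it is absent from the mean and contributes the term with the gain in the last
block of `Nz`. The own noise enters the next own type only. -/
theorem yVec_eq (h : PrivHist n m i t) (a : Fin (m i) → ℝ)
    (p : TypeHist n (opp i) t × (Fin (n i) → ℝ)) :
    G.yVec θ i t h a p = G.yMean θ i t h a + G.yNoise θ i t p := by
  have hb : G.playAction θ i t h.1 a p.1 (opp i) =
      G.meanAction θ (opp i) t h.1 + θ.L t (G.cov θ t) (opp i) *ᵥ p.1 (Fin.last t) := by
    rw [playAction, pairUp_opp, action_histMean_add]
  have ha : G.playAction θ i t h.1 a p.1 i = a := by rw [playAction, pairUp_self]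
  have hmb : θ.Mboth t (G.cov θ t) i *ᵥ G.meanVec θ i t h.1 =
      Sum.elim (θ.M t (G.cov θ t) i *ᵥ stack (G.mean θ t h.1))
        (θ.M t (G.cov θ t) (opp i) *ᵥ stack (G.mean θ t h.1)) := by
    rw [GenFun.Mboth, fromRows_mulVec, ← M_mulVec_stack_mean, ← M_mulVec_stack_mean]
  have hy : G.yVec θ i t h a p = yElim a (G.playAction θ i t h.1 a p.1 (opp i))
      (h.2 (Fin.last t)) ((G.histMean θ (opp i) t h.1 + p.1) (Fin.last t))
      (G.nextType t i (h.2 (Fin.last t)) (G.playAction θ i t h.1 a p.1) p.2)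
      (G.mean θ (t + 1) (Fin.snoc (α := fun _ => Joint m) h.1 (G.playAction θ i t h.1 a p.1)) i)
      (G.mean θ (t + 1) (Fin.snoc (α := fun _ => Joint m) h.1 (G.playAction θ i t h.1 a p.1))
        (opp i)) := by
    simp only [yVec, estVec, meanVec, nextPriv, Fin.snoc_last]
    rfl
  have hmean : ∀ u j, G.mean θ (t + 1) (Fin.snoc (α := fun _ => Joint m) h.1 u) j =
      G.meanUpdate t (G.mean θ t h.1) (G.cov θ t) (θ.L t (G.cov θ t))
        (fun j => θ.M t (G.cov θ t) j *ᵥ stack (G.mean θ t h.1)) u j := fun u j => by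
    simp only [mean, Fin.snoc_castSucc, Fin.snoc_last]
  rw [hy, hmean, hmean]
  simp only [yMean, hmb]
  simp only [yNoise, Nz, Nw, Du, De₁, De₂₃, Cmat, meanVec, yRows_mulVec, yElim_add, meanUpdate,
    nextType, G.B_mulVec_stack i, hb, ha, fromCols_mulVec_sumElim, Pi.add_apply, histMean_last,
    meanAction]
  congr 1 <;> simp only [Matrix.zero_mulVec, Matrix.one_mulVec, Matrix.add_mulVec,
    Matrix.sub_mulVec, Matrix.neg_mulVec, Matrix.mulVec_add, Matrix.mulVec_sub,
    ← Matrix.mulVec_mulVec, Matrix.mul_sub, Matrix.mul_one] <;> abel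

/-! ### The Bellman equation -/

theorem quad_Vbar (V : Matrix (EIdx n i) (EIdx n i) ℝ) (x : Joint n) (u : Joint m)
    (e : EIdx n i → ℝ) :
    quad (G.Vbar i V) (Sum.elim (Sum.elim (Sum.elim (u i) (u (opp i)))
      (Sum.elim (x i) (x (opp i)))) e) = G.stageCost i x u + quad V e := by
  set U := Sum.elim (u i) (u (opp i))
  set X := Sum.elim (x i) (x (opp i))
  have hS : X ⬝ᵥ ((G.costS i)ᵀ.submatrix (selfFirst n i) (selfFirst m i) *ᵥ U) =
      U ⬝ᵥ ((G.costS i).submatrix (selfFirst m i) (selfFirst n i) *ᵥ X) := by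
    rw [← Matrix.transpose_submatrix, Matrix.mulVec_transpose, dotProduct_comm,
      ← Matrix.dotProduct_mulVec]
  rw [stageCost, stack_dotProduct i, stack_dotProduct i, stack_dotProduct i,
    mulVec_stack_selfFirst i, mulVec_stack_selfFirst i, mulVec_stack_selfFirst i]
  simp only [quad, Vbar, fromBlocks_mulVec, Sum.elim_comp_inl, Sum.elim_comp_inr,
    sumElim_dotProduct_sumElim, Matrix.zero_mulVec, add_zero, zero_add, dotProduct_add]
  rw [hS]
  ring

theorem isSymm_Vbar {V : Matrix (EIdx n i) (EIdx n i) ℝ} (hV : V.IsSymm) :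
    (G.Vbar i V : Matrix (YIdx n m i) (YIdx n m i) ℝ).IsSymm := by
  refine Matrix.IsSymm.fromBlocks (Matrix.IsSymm.fromBlocks ?_ ?_ ?_) ?_ hV
  · exact (G.costT_symm i).submatrix _
  · rw [Matrix.transpose_submatrix]
  · exact (G.costP_symm i).submatrix _
  · exact Matrix.transpose_zero

theorem isSymm_valueAux (k : ℕ) (S : Cov n) : (G.valueAux θ k t S i).IsSymm := by
  induction k generalizing t S with
  | zero => exact Matrix.transpose_zero
  | succ k ih =>
    have h := G.isSymm_Vbar i (ih (t + 1) (G.covUpdate t S (θ.L t S)))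
    rw [valueAux, Matrix.IsSymm, Matrix.transpose_mul, Matrix.transpose_mul,
      Matrix.transpose_transpose, h.eq, Matrix.mul_assoc]

/-- The law of the other player's type history, relative to its mean, and of the own noise. -/
def roundLaw : Measure (TypeHist n (opp i) t × (Fin (n i) → ℝ)) :=
  (G.noiseLaw θ (opp i) t).prod (gauss (0 : Fin (n i) → ℝ) (G.Q i))

instance isGaussian_roundLaw : IsGaussian (G.roundLaw θ i t) := by
  unfold roundLaw
  infer_instance

/-- `V̄_t^i` with `k` stages left to play after stage `t`. -/
def vbarAux (k : ℕ) : Matrix (YIdx n m i) (YIdx n m i) ℝ :=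
  G.Vbar i (G.valueAux θ k (t + 1) (G.cov θ (t + 1)) i)

/-- The constant term of the value function with `k` stages left to play. -/
def valueConst : (k t : ℕ) → ℝ
  | 0, _ => 0
  | k + 1, t => (∫ p, quad (G.vbarAux θ i t k) (G.yNoise θ i t p) ∂(G.roundLaw θ i t)) +
      valueConst k (t + 1)

/-- The value function of player `i` with `k` stages left to play. -/
def valueFun (k : ℕ) (h : PrivHist n m i t) : ℝ :=
  quad (G.valueAux θ k t (G.cov θ t) i) (G.estVec θ i t h) + G.valueConst θ i k t

/-- The expected cost when playing `a` with `k` stages left to play after the present one. -/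
def actionValue (k : ℕ) (h : PrivHist n m i t) (a : Fin (m i) → ℝ) : ℝ :=
  quad (G.vbarAux θ i t k) (G.yMean θ i t h a) + G.valueConst θ i (k + 1) t

/-- The cost of the present stage. -/
def roundCost (h : PrivHist n m i t) (a : Fin (m i) → ℝ) (z : TypeHist n (opp i) t) : ℝ :=
  G.stageCost i (pairUp i (h.2 (Fin.last t)) ((G.histMean θ (opp i) t h.1 + z) (Fin.last t)))
    (G.playAction θ i t h.1 a z)

theorem sqIntegrable_yNoise : SqIntegrable (G.yNoise θ i t) (G.roundLaw θ i t) := by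
  refine sqIntegrable_of_hasGaussianLaw (hasGaussianLaw_of_isLinearMap _ ⟨fun p q => ?_,
    fun c p => ?_⟩)
  · simp only [yNoise, Prod.fst_add, Prod.snd_add, Pi.add_apply, Matrix.mulVec_add]
    abel
  · simp only [yNoise, Prod.smul_fst, Prod.smul_snd, Pi.smul_apply, Matrix.mulVec_smul, smul_add]

theorem integral_yNoise (k : YIdx n m i) : ∫ p, G.yNoise θ i t p k ∂(G.roundLaw θ i t) = 0 := by
  have s1 : SqIntegrable (fun p : TypeHist n (opp i) t × (Fin (n i) → ℝ) => p.1 (Fin.last t))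
      (G.roundLaw θ i t) := sqIntegrable_of_hasGaussianLaw
    (hasGaussianLaw_of_isLinearMap _ ⟨fun _ _ => rfl, fun _ _ => rfl⟩)
  have s2 : SqIntegrable (fun p : TypeHist n (opp i) t × (Fin (n i) → ℝ) => p.2)
      (G.roundLaw θ i t) := sqIntegrable_of_hasGaussianLaw
    (hasGaussianLaw_of_isLinearMap _ ⟨fun _ _ => rfl, fun _ _ => rfl⟩)
  have m1 : ∀ a, ∫ p, p.1 (Fin.last t) a ∂(G.roundLaw θ i t) = 0 := fun a => by
    rw [roundLaw, integral_fun_fst (fun z : TypeHist n (opp i) t => z (Fin.last t) a),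
      ← integral_map (φ := fun z : TypeHist n (opp i) t => z (Fin.last t)) (f := fun x => x a)
        (measurable_pi_apply _).aemeasurable (aestronglyMeasurable_apply _ _), noiseLaw_map_last, integral_gauss]
    simp
  have m2 : ∀ a, ∫ p, p.2 a ∂(G.roundLaw θ i t) = 0 := fun a => by
    rw [roundLaw, integral_fun_snd (fun w : Fin (n i) → ℝ => w a), integral_gauss]
    simp
  simp only [yNoise, Pi.add_apply]
  rw [integral_add (((s1.mulVec _) k).integrable (by norm_num))
    (((s2.mulVec _) k).integrable (by norm_num)), integral_mulVec_eq_zero s1 m1,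
    integral_mulVec_eq_zero s2 m2, add_zero]

theorem sqIntegrable_yVec (h : PrivHist n m i t) (a : Fin (m i) → ℝ) :
    SqIntegrable (G.yVec θ i t h a) (G.roundLaw θ i t) := by
  have e : G.yVec θ i t h a = fun p => G.yMean θ i t h a + G.yNoise θ i t p :=
    funext (G.yVec_eq θ i t h a)
  rw [e]
  exact SqIntegrable.add (fun k => memLp_const _) (G.sqIntegrable_yNoise θ i t)

theorem quad_vbar_yVec (V : Matrix (EIdx n i) (EIdx n i) ℝ) (h : PrivHist n m i t)
    (a : Fin (m i) → ℝ) (p : TypeHist n (opp i) t × (Fin (n i) → ℝ)) :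
    quad (G.Vbar i V) (G.yVec θ i t h a p) = G.roundCost θ i t h a p.1 +
      quad V (G.estVec θ i (t + 1) (G.nextPriv i t h (G.playAction θ i t h.1 a p.1) p.2)) := by
  have ha : G.playAction θ i t h.1 a p.1 i = a := by rw [playAction, pairUp_self]
  rw [roundCost, ← quad_Vbar, pairUp_self, pairUp_opp, ha]
  rfl

theorem integrable_roundCost (h : PrivHist n m i t) (a : Fin (m i) → ℝ) :
    Integrable (fun p => G.roundCost θ i t h a p.1) (G.roundLaw θ i t) := by
  -- With continuation matrix `0` the quadratic form is the stage cost alone.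
  have h1 := integrable_quad (G.sqIntegrable_yVec θ i t h a) (G.Vbar i 0)
  have h2 : ∀ e : EIdx n i → ℝ, quad 0 e = 0 := fun e => by simp [quad]
  simpa only [quad_vbar_yVec, h2, add_zero] using h1

theorem integrable_valueFun_nextPriv (k : ℕ) (h : PrivHist n m i t) (a : Fin (m i) → ℝ) :
    Integrable (fun p => G.valueFun θ i (t + 1) k
      (G.nextPriv i t h (G.playAction θ i t h.1 a p.1) p.2)) (G.roundLaw θ i t) := by
  -- The continuation term is the whole quadratic form minus the stage cost, both integrable.
  have h1 := (integrable_quad (G.sqIntegrable_yVec θ i t h a) (G.vbarAux θ i t k)).sub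
    (G.integrable_roundCost θ i t h a)
  refine Integrable.add ?_ (integrable_const _)
  refine h1.congr (Filter.Eventually.of_forall fun p => ?_)
  simp only [Pi.sub_apply, vbarAux, quad_vbar_yVec, add_sub_cancel_left]

/-- The noise is centered, so the cross terms have mean zero; the mean of its own quadratic term
does not depend on `a` and is the increment of `valueConst`. -/
theorem integral_roundCost_add (k : ℕ) (h : PrivHist n m i t) (a : Fin (m i) → ℝ) :
    (∫ p, G.roundCost θ i t h a p.1 ∂(G.roundLaw θ i t)) +
      ∫ p, G.valueFun θ i (t + 1) k (G.nextPriv i t h (G.playAction θ i t h.1 a p.1) p.2)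
        ∂(G.roundLaw θ i t) = G.actionValue θ i t k h a := by
  rw [← integral_add (G.integrable_roundCost θ i t h a)
    (G.integrable_valueFun_nextPriv θ i t k h a)]
  have e : ∀ p, G.roundCost θ i t h a p.1 + G.valueFun θ i (t + 1) k
      (G.nextPriv i t h (G.playAction θ i t h.1 a p.1) p.2) =
      quad (G.vbarAux θ i t k) (G.yMean θ i t h a + G.yNoise θ i t p) +
        G.valueConst θ i k (t + 1) := fun p => by
    rw [← yVec_eq, vbarAux, quad_vbar_yVec, valueFun]
    ring
  simp only [e]
  have hi : Integrable (fun p => quad (G.vbarAux θ i t k)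
      (G.yMean θ i t h a + G.yNoise θ i t p)) (G.roundLaw θ i t) := by
    simpa only [yVec_eq] using
      integrable_quad (G.sqIntegrable_yVec θ i t h a) (G.vbarAux θ i t k)
  have hsym : (G.vbarAux θ i t k).IsSymm := G.isSymm_Vbar i (G.isSymm_valueAux θ i _ _ _)
  rw [integral_add hi (integrable_const _), integral_quad_const_add (G.sqIntegrable_yNoise θ i t)
    (G.integral_yNoise θ i t) hsym, actionValue,
    valueConst]
  simp [add_assoc]

/-- `F` gives the closed-loop mean. Another own action shifts it by `D^{ui}` times the difference
only, since the belief update still subtracts the prescribed constant terms, whatever is played. -/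
theorem yMean_eq (h : PrivHist n m i t) (a : Fin (m i) → ℝ) :
    G.yMean θ i t h a = G.Fmat θ t (G.cov θ t) i *ᵥ G.estVec θ i t h +
      G.Du t (G.cov θ t) (θ.L t (G.cov θ t)) i *ᵥ (a - G.action θ i t h) := by
  have hm := G.M_mulVec_stack_mean θ i t i h.1
  rw [← GenFun.Mself] at hm
  rw [action, hm]
  simp only [yMean, Fmat, estVec, Matrix.add_mulVec, fromCols_mulVec_sumElim, Matrix.mulVec_sub,
    Matrix.mulVec_add, ← Matrix.mulVec_mulVec]
  abel

/-- This is `V = Fᵀ V̄ F` and involves no optimality: the value function evaluates the prescribed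
strategies for any costs, a fact on which the auxiliary game relies. -/
theorem actionValue_action (k : ℕ) (h : PrivHist n m i t) :
    G.actionValue θ i t k h (G.action θ i t h) = G.valueFun θ i t (k + 1) h := by
  rw [actionValue, yMean_eq, sub_self, Matrix.mulVec_zero, add_zero, quad_mulVec]
  rfl

/-- Completing the square around the prescribed action: the linear term vanishes by the first-order
conditions and the quadratic term is nonnegative. -/
theorem valueFun_le_actionValue {k : ℕ} (hk : t + (k + 1) = G.horizon)
    (hs : G.Solves θ t (G.cov θ t)) (h : PrivHist n m i t) (a : Fin (m i) → ℝ) :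
    G.valueFun θ i t (k + 1) h ≤ G.actionValue θ i t k h a := by
  set D := G.Du t (G.cov θ t) (θ.L t (G.cov θ t)) i with hD
  have hV : G.valueBar θ t (G.cov θ t) i = G.vbarAux θ i t k := by
    rw [valueBar, value, show G.horizon - (t + 1) = k by omega]
    rfl
  have hp := hs.posDef i
  have hL := hs.eq_L i
  have hM := hs.eq_M i
  rw [hV, ← hD] at hp hL hM
  set V := G.vbarAux θ i t k with hVd
  have hsym : V.IsSymm := G.isSymm_Vbar i (G.isSymm_valueAux θ i _ _ _)
  -- On the column block of `x^i` this is the equation for `L`, on that of the means the equation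
  -- for `M`.
  have h0 : Dᵀ * V * G.Fmat θ t (G.cov θ t) i = 0 := by
    rw [Fmat, Matrix.mul_add, mul_fromCols, mul_fromCols, Matrix.mul_add, ← hD,
      ← Matrix.mul_assoc, ← Matrix.mul_assoc (Dᵀ * V), ← Matrix.mul_assoc (Dᵀ * V), hL, hM]
    ext r q
    rcases q with q | q <;> simp
  rw [actionValue, yMean_eq, quad_add hsym, valueFun]
  have h1 : quad V (G.Fmat θ t (G.cov θ t) i *ᵥ G.estVec θ i t h) =
      quad (G.valueAux θ (k + 1) t (G.cov θ t) i) (G.estVec θ i t h) := by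
    rw [quad_mulVec]; rfl
  have h2 : (D *ᵥ (a - G.action θ i t h)) ⬝ᵥ
      (V *ᵥ (G.Fmat θ t (G.cov θ t) i *ᵥ G.estVec θ i t h)) = 0 := by
    rw [← Matrix.vecMul_transpose, ← Matrix.dotProduct_mulVec, Matrix.mulVec_mulVec,
      Matrix.mulVec_mulVec, h0, Matrix.zero_mulVec, dotProduct_zero]
  have h3 : 0 ≤ quad V (D *ᵥ (a - G.action θ i t h)) := by
    rw [quad_mulVec]
    have := hp.posSemidef.dotProduct_mulVec_nonneg (a - G.action θ i t h)
    simpa [quad] using this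
  rw [← hD, h1, h2]
  linarith

end Game

end LQG

namespace LQG

variable {n m : Fin 2 → ℕ}

namespace Game

variable (G : Game n m) (θ : GenFun n m) (i : Fin 2)

/-! ### Dynamic programming -/

theorem roundCost_eq_costAt (t : ℕ) (h : PrivHist n m i t) (a : Fin (m i) → ℝ)
    (p : TypeHist n (opp i) t × (Fin (n i) → ℝ) × (Fin (n (opp i)) → ℝ)) :
    G.costAt i t (G.nextHist θ i t h a p) = G.roundCost θ i t h a p.1 :=
  G.costAt_extend i t _ _ _

theorem integrable_roundCost' (t : ℕ) (h : PrivHist n m i t) (a : Fin (m i) → ℝ) :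
    Integrable (G.roundCost θ i t h a) (G.noiseLaw θ (opp i) t) := by
  have h1 := G.integrable_roundCost θ i t h a
  exact Integrable.of_comp_fst h1 (IsProbabilityMeasure.ne_zero _)

/-- The cost of the first stage of play, when playing `a`. -/
theorem integrable_costAt_playLaw (t : ℕ) (h : PrivHist n m i t) (a : Fin (m i) → ℝ) :
    Integrable (G.costAt i t) (G.playLaw θ i t h a) := by
  rw [playLaw, integrable_map_measure (G.measurable_costAt i t _).aestronglyMeasurable
    (by fun_prop)]
  exact (Integrable.comp_fst (G.integrable_roundCost' θ i t h a) _).congr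
    (Filter.Eventually.of_forall fun p => (G.roundCost_eq_costAt θ i t h a p).symm)

theorem integral_costAt_playLaw (t : ℕ) (h : PrivHist n m i t) (a : Fin (m i) → ℝ) :
    ∫ x, G.costAt i t x ∂(G.playLaw θ i t h a) =
      ∫ p, G.roundCost θ i t h a p.1 ∂(G.roundLaw θ i t) := by
  rw [playLaw, integral_map (by fun_prop) (G.measurable_costAt i t _).aestronglyMeasurable]
  simp only [roundCost_eq_costAt]
  rw [roundLaw, integral_fun_fst (G.roundCost θ i t h a),
    integral_fun_fst (G.roundCost θ i t h a)]
  simp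

theorem integrable_of_map {Ω : Type} [MeasurableSpace Ω] {P : Measure Ω} {f : Ω → ℝ}
    (hf : Measurable f) : Integrable f P ↔ Integrable (fun x : ℝ => x) (P.map f) :=
  (integrable_map_measure aestronglyMeasurable_id hf.aemeasurable).symm

/-- If the strategy of player `i` satisfies the Bellman inequality, multiplied by `σ`, at every
stage, then the value function, multiplied by `σ`, bounds the expected cost-to-go from below. -/
theorem lowerBound_evolve (σ : ℝ) (N : ℕ) (g : Profile n m)
    (hg : ∀ j s, IsMarkovKernel (g j s)) (ho : ∀ t, g (opp i) t = G.betaStar θ (opp i) t)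
    (hB : ∀ t k, t + (k + 1) = N → ∀ h : PrivHist n m i t, ∀ᵐ a ∂(g i t h),
      σ * G.valueFun θ i t (k + 1) h ≤ σ * G.actionValue θ i t k h a)
    (k t : ℕ) (hk : t + k = N) (h : PrivHist n m i t) :
    LowerBound ((G.beliefs θ i t h).bind (G.evolve g t k)) (fun x => σ * G.costFrom i t x)
      (σ * G.valueFun θ i t k h) := by
  induction k generalizing t with
  | zero =>
    have h1 : ∀ x : Hist n m (t + 0), σ * G.costFrom i t x = 0 := fun x => by
      rw [G.costFrom_eq_zero i le_rfl, mul_zero]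
    have h2 : G.valueFun θ i t 0 h = 0 := by
      simp [valueFun, valueAux, valueConst, quad]
    simp only [LowerBound, h1, h2, mul_zero, neg_zero, ENNReal.ofReal_zero, lintegral_zero, le_refl]
  | succ k ih =>
    have hgi := hg i t
    have hcf : ∀ r s : ℕ, Measurable fun x : Hist n m s => σ * G.costFrom i r x := fun r s =>
      (G.measurable_costFrom i r s).const_mul σ
    set Pa : (Fin (m i) → ℝ) → Measure (Hist n m (t + 1 + k)) := fun a =>
      (G.playLaw θ i t h a).bind (G.evolve g (t + 1) k) with hPa
    -- The own action is averaged last. The identity is for nonnegative functions and is used on the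
    -- positive and negative parts of the cost.
    have hsplit : ∀ f : (s : ℕ) → Hist n m s → ℝ≥0∞, (∀ s, Measurable (f s)) →
        ∫⁻ x, f (t + (k + 1)) x ∂((G.beliefs θ i t h).bind (G.evolve g t (k + 1))) =
          ∫⁻ a, ∫⁻ x, f (t + 1 + k) x ∂(Pa a) ∂(g i t h) := fun f hf => by
      have hm : Measurable fun y => ∫⁻ x, f (t + 1 + k) x ∂(G.evolve g (t + 1) k y) :=
        (hf _).lintegral_kernel
      refine (Measure.lintegral_bind (Kernel.aemeasurable _) (hf _).aemeasurable).trans ?_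
      simp only [G.lintegral_evolve_succ g t k f hf]
      rw [← Measure.lintegral_bind (Kernel.aemeasurable _) hm.aemeasurable,
        G.lintegral_beliefs_bind_step θ i t g hg (ho t) h hm]
      refine lintegral_congr fun a => ?_
      exact (Measure.lintegral_bind (Kernel.aemeasurable _) (hf _).aemeasurable).symm
    -- Given the action, the continuation is a mixture, over the next private histories, of the laws
    -- covered by the induction hypothesis.
    have hlater : ∀ a, LowerBound (Pa a) (fun x => σ * G.costFrom i (t + 1) x)
        (σ * ∫ p, G.valueFun θ i (t + 1) k (G.nextPriv i t h (G.playAction θ i t h.1 a p.1) p.2)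
          ∂(G.roundLaw θ i t)) := fun a => by
      have hsp : ∀ f : Hist n m (t + 1 + k) → ℝ≥0∞, Measurable f →
          ∫⁻ x, f x ∂(Pa a) = ∫⁻ p, ∫⁻ x, f x ∂((G.beliefs θ i (t + 1)
            (G.nextPriv i t h (G.playAction θ i t h.1 a p.1) p.2)).bind (G.evolve g (t + 1) k))
              ∂(G.roundLaw θ i t) := fun f hf => by
        have hm : Measurable fun y => ∫⁻ x, f x ∂(G.evolve g (t + 1) k y) := hf.lintegral_kernel
        have hm2 : Measurable fun h' => ∫⁻ y, ∫⁻ x, f x ∂(G.evolve g (t + 1) k y)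
            ∂(G.beliefs θ i (t + 1) h') := hm.lintegral_kernel
        rw [hPa, Measure.lintegral_bind (Kernel.aemeasurable _) hf.aemeasurable,
          G.lintegral_playLaw_eq_beliefs θ i t h a hm, roundLaw]
        simp only [Measure.lintegral_bind (Kernel.aemeasurable _) hf.aemeasurable]
        exact (lintegral_prod (fun p => ∫⁻ y, ∫⁻ x, f x ∂(G.evolve g (t + 1) k y)
            ∂(G.beliefs θ i (t + 1) (G.nextPriv i t h (G.playAction θ i t h.1 a p.1) p.2)))
          (hm2.comp (by fun_prop)).aemeasurable).symm
      rw [← integral_const_mul]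
      refine LowerBound.mixture (hsp _ (hcf _ _).ennreal_ofReal)
        (hsp _ (hcf _ _).neg.ennreal_ofReal)
        ((G.integrable_valueFun_nextPriv θ i t k h a).const_mul σ)
        (Filter.Eventually.of_forall fun p => ih (t + 1) (by omega) _)
    -- For a fixed action the stage cost is a quadratic function of a Gaussian vector, hence
    -- integrable; only its law matters, and later play does not change that law.
    have hnow : ∀ a, Integrable (fun x => σ * G.costAt i t x) (Pa a) ∧
        ∫ x, σ * G.costAt i t x ∂(Pa a) =
          σ * ∫ p, G.roundCost θ i t h a p.1 ∂(G.roundLaw θ i t) := fun a => by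
      have hm := G.map_costAt_evolve g hg i t k (G.playLaw θ i t h a)
      have hi : Integrable (fun x => G.costAt i t x) (Pa a) := by
        have := G.integrable_costAt_playLaw θ i t h a
        rw [integrable_of_map (G.measurable_costAt i t _)] at this ⊢
        rwa [hm]
      refine ⟨hi.const_mul σ, ?_⟩
      rw [integral_const_mul, ← integral_costAt_playLaw,
        ← integral_map (φ := G.costAt i t) (f := fun x => x)
          (G.measurable_costAt i t _).aemeasurable aestronglyMeasurable_id,
        ← integral_map (φ := G.costAt i t) (f := fun x => x) (μ := G.playLaw θ i t h a)
          (G.measurable_costAt i t _).aemeasurable aestronglyMeasurable_id, hm]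
    have hall : ∀ a, LowerBound (Pa a) (fun x => σ * G.costFrom i t x)
        (σ * G.actionValue θ i t k h a) := fun a => by
      have := (hlater a).integrable_add (hcf _ _) (hnow a).1
      rw [(hnow a).2, ← mul_add, integral_roundCost_add] at this
      simpa only [← mul_add, ← costFrom_eq_add] using this
    -- The constant is written as its own average over the own action, because `LowerBound.mixture`
    -- yields averaged bounds.
    have hc : ∫ _, σ * G.valueFun θ i t (k + 1) h ∂(g i t h) = σ * G.valueFun θ i t (k + 1) h := by
      simp
    rw [← hc]
    refine LowerBound.mixture
      (hsplit (fun s x => ENNReal.ofReal (σ * G.costFrom i t x)) fun s =>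
        (hcf _ _).ennreal_ofReal)
      (hsplit (fun s x => ENNReal.ofReal (-(σ * G.costFrom i t x))) fun s =>
        (hcf _ _).neg.ennreal_ofReal)
      (integrable_const _) ?_
    filter_upwards [hB t k hk h] with a ha
    exact (hall a).mono (hcf _ _) ha

end Game

end LQG

namespace LQG

variable {n m : Fin 2 → ℕ}

/-! ### Domination of the costs -/

theorem abs_dotProduct_mulVec_le {a b : Type} [Fintype a] [Fintype b] (M : Matrix a b ℝ)
    (v : a → ℝ) (w : b → ℝ) :
    |v ⬝ᵥ (M *ᵥ w)| ≤ (∑ k, ∑ l, |M k l|) * (v ⬝ᵥ v + w ⬝ᵥ w) := by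
  have h1 : v ⬝ᵥ (M *ᵥ w) = ∑ k, ∑ l, M k l * (v k * w l) := by
    simp only [dotProduct, Matrix.mulVec, Finset.mul_sum]
    exact Finset.sum_congr rfl fun k _ => Finset.sum_congr rfl fun l _ => by ring
  have hv : ∀ k, v k * v k ≤ v ⬝ᵥ v := fun k =>
    Finset.single_le_sum (f := fun k => v k * v k) (fun _ _ => mul_self_nonneg _)
      (Finset.mem_univ k)
  have hw : ∀ l, w l * w l ≤ w ⬝ᵥ w := fun l =>
    Finset.single_le_sum (f := fun l => w l * w l) (fun _ _ => mul_self_nonneg _)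
      (Finset.mem_univ l)
  rw [h1, Finset.sum_mul]
  refine (Finset.abs_sum_le_sum_abs _ _).trans (Finset.sum_le_sum fun k _ => ?_)
  rw [Finset.sum_mul]
  refine (Finset.abs_sum_le_sum_abs _ _).trans (Finset.sum_le_sum fun l _ => ?_)
  rw [abs_mul]
  refine mul_le_mul_of_nonneg_left ?_ (abs_nonneg _)
  have := hv k
  have := hw l
  rw [abs_le]
  constructor <;> nlinarith [mul_self_nonneg (v k + w l), mul_self_nonneg (v k - w l),
    mul_self_nonneg (v k), mul_self_nonneg (w l)]

namespace Game

variable (G : Game n m) (θ : GenFun n m)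

/-- The game with the same dynamics and with the costs `-c |(x, u)|^2`. -/
def withNormCost (c : ℝ) : Game n m :=
  { G with
    costT := fun _ => (-c) • 1
    costP := fun _ => (-c) • 1
    costS := fun _ => 0
    costT_symm := fun _ => Matrix.isSymm_one.smul _
    costP_symm := fun _ => Matrix.isSymm_one.smul _ }

theorem withNormCost_stageCost (c : ℝ) (i : Fin 2) (x : Joint n) (u : Joint m) :
    (G.withNormCost c).stageCost i x u = -(c * (stack u ⬝ᵥ stack u + stack x ⬝ᵥ stack x)) := by
  simp only [stageCost, withNormCost, Matrix.smul_mulVec, Matrix.one_mulVec, Matrix.zero_mulVec,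
    dotProduct_smul, dotProduct_zero, smul_eq_mul]
  ring

theorem exists_abs_stageCost_le (i : Fin 2) : ∃ c : ℝ, 0 ≤ c ∧ ∀ (x : Joint n) (u : Joint m),
    |G.stageCost i x u| ≤ -(G.withNormCost c).stageCost i x u := by
  set a := ∑ k, ∑ l, |G.costT i k l| with ha
  set b := ∑ k, ∑ l, |G.costP i k l| with hb
  set d := ∑ k, ∑ l, |G.costS i k l| with hd
  have ha0 : 0 ≤ a := by positivity
  have hb0 : 0 ≤ b := by positivity
  have hd0 : 0 ≤ d := by positivity
  -- With `U = |u|²` and `X = |x|²`, the three terms are at most `2aU`, `2bX` and `2d(U + X)`.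
  refine ⟨2 * a + 2 * b + 2 * d, by positivity, fun x u => ?_⟩
  have h1 := abs_dotProduct_mulVec_le (G.costT i) (stack u) (stack u)
  have h2 := abs_dotProduct_mulVec_le (G.costP i) (stack x) (stack x)
  have h3 := abs_dotProduct_mulVec_le (G.costS i) (stack u) (stack x)
  rw [← ha] at h1
  rw [← hb] at h2
  rw [← hd] at h3
  have hu : 0 ≤ stack u ⬝ᵥ stack u := Finset.sum_nonneg fun _ _ => mul_self_nonneg _
  have hx : 0 ≤ stack x ⬝ᵥ stack x := Finset.sum_nonneg fun _ _ => mul_self_nonneg _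
  rw [withNormCost_stageCost, neg_neg, stageCost]
  set U := stack u ⬝ᵥ stack u
  set X := stack x ⬝ᵥ stack x
  have e1 := mul_nonneg ha0 hx
  have e2 := mul_nonneg hb0 hu
  rw [abs_le] at h1 h2 h3 ⊢
  constructor <;> nlinarith

theorem withNormCost_cov (c : ℝ) : (G.withNormCost c).cov θ = G.cov θ := by
  funext t
  induction t with
  | zero => rfl
  | succ t ih => rw [cov, ih]; rfl

theorem withNormCost_mean (c : ℝ) (t : ℕ) : (G.withNormCost c).mean θ t = G.mean θ t := by
  induction t with
  | zero => rfl
  | succ t ih =>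
    funext u
    rw [mean, ih, withNormCost_cov]
    rfl

theorem withNormCost_betaStar (c : ℝ) : (G.withNormCost c).betaStar θ = G.betaStar θ := by
  have h : ∀ i t, (G.withNormCost c).action θ i t = G.action θ i t := fun i t => by
    funext h
    rw [action, action, withNormCost_cov, withNormCost_mean]
  funext i t
  simp only [betaStar, h]

theorem withNormCost_beliefs (c : ℝ) : (G.withNormCost c).beliefs θ = G.beliefs θ := by
  have h1 : ∀ j t, (G.withNormCost c).noiseLaw θ j t = G.noiseLaw θ j t := fun j t => by
    induction t with
    | zero => rfl
    | succ t ih => rw [noiseLaw, ih, withNormCost_cov]; rfl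
  have h3 : ∀ j t, (G.withNormCost c).postMean θ j t = G.postMean θ j t := fun j t => by
    funext x u a k
    simp only [postMean, meanAction, withNormCost_cov, withNormCost_mean, h1]
  have h2 : ∀ j t, (G.withNormCost c).histMean θ j t = G.histMean θ j t := fun j t => by
    induction t with
    | zero => rfl
    | succ t ih =>
      funext u
      simp only [histMean, ih, h3]
      rfl
  funext i t
  simp only [beliefs, h1, h2]

theorem withNormCost_evolve (c : ℝ) (g : Profile n m) (t k : ℕ) :
    (G.withNormCost c).evolve g t k = G.evolve g t k := by
  induction k with
  | zero => rfl
  | succ k ih => rw [evolve, ih]; rfl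

/-! ### Sequential rationality -/

/-- At the prescribed action the Bellman inequality is an equality, so it holds for both signs of
`σ`. -/
theorem betaStar_bellman (i : Fin 2) (σ : ℝ) (t k : ℕ) (h : PrivHist n m i t) :
    ∀ᵐ a ∂(G.betaStar θ i t h),
      σ * G.valueFun θ i t (k + 1) h ≤ σ * G.actionValue θ i t k h a := by
  rw [betaStar, Kernel.deterministic_apply, ae_dirac_eq]
  simp only [Filter.eventually_pure, actionValue_action, le_refl]

/-- The auxiliary cost is nonpositive and dominates the true cost in absolute value. Its positive
part vanishes, so a finite lower bound on its expectation already makes it integrable. Beliefs,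
strategies and dynamics do not involve the costs and are shared by the two games. -/
theorem integrable_costFrom (i : Fin 2) (t k : ℕ) (h : PrivHist n m i t) :
    Integrable (G.costFrom i t) ((G.beliefs θ i t h).bind (G.evolve (G.betaStar θ) t k)) := by
  obtain ⟨c, hc, hle⟩ := G.exists_abs_stageCost_le i
  set G' := G.withNormCost c with hG'
  have hlb := G'.lowerBound_evolve θ i 1 (t + k) (G'.betaStar θ) (fun _ _ => inferInstance)
    (fun _ => rfl) (fun s l _ h' => G'.betaStar_bellman θ i 1 s l h') k t rfl h
  rw [hG', withNormCost_betaStar, withNormCost_beliefs, withNormCost_evolve, ← hG'] at hlb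
  simp only [one_mul] at hlb
  have hcost : ∀ x : Hist n m (t + k), |G.costFrom i t x| ≤ -G'.costFrom i t x := fun x => by
    rw [costFrom, costFrom, ← Finset.sum_neg_distrib]
    refine (Finset.abs_sum_le_sum_abs _ _).trans (Finset.sum_le_sum fun l _ => ?_)
    split_ifs
    · exact hle _ _
    · simp
  have hneg : ∀ x : Hist n m (t + k), G'.costFrom i t x ≤ 0 := fun x => by
    have := (abs_nonneg _).trans (hcost x)
    linarith
  have hi := hlb.integrable (G'.measurable_costFrom i t _) (by
    simp only [ENNReal.ofReal_of_nonpos (hneg _), lintegral_zero]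
    exact ENNReal.zero_ne_top)
  refine hi.neg.mono' (G.measurable_costFrom i t _).aestronglyMeasurable ?_
  exact Filter.Eventually.of_forall hcost

/-- With `σ = -1` the lower bound for the negated cost is an upper bound for the cost. -/
theorem integral_costFrom_le (i : Fin 2) (t k : ℕ) (h : PrivHist n m i t) :
    ∫ x, G.costFrom i t x ∂((G.beliefs θ i t h).bind (G.evolve (G.betaStar θ) t k)) ≤
      G.valueFun θ i t k h := by
  have hlb := G.lowerBound_evolve θ i (-1) (t + k) (G.betaStar θ) (fun _ _ => inferInstance)
    (fun _ => rfl) (fun s l _ h' => G.betaStar_bellman θ i (-1) s l h') k t rfl h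
  rw [lowerBound_iff_of_integrable ((G.integrable_costFrom θ i t k h).const_mul _),
    integral_const_mul] at hlb
  linarith

/-- The value function separates the two costs: it is at least the cost of the prescribed strategy
and at most that of any deviation. -/
theorem isSequentiallyRational_betaStar
    (hθ : ∀ t, t < G.horizon → G.Solves θ t (G.cov θ t)) :
    G.IsSequentiallyRational (G.betaStar θ) (G.beliefs θ) := by
  intro i t k _ hk h
  have hi := G.integrable_costFrom θ i t k h
  refine ⟨hi, fun g hg he => ?_⟩
  set g' := Function.update (G.betaStar θ) i g with hg'
  have hM : ∀ j s, IsMarkovKernel (g' j s) := fun j s => by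
    by_cases hj : j = i
    · subst hj
      rw [hg', Function.update_self]
      exact hg s
    · rw [hg', Function.update_of_ne hj]
      infer_instance
  have hlb := G.lowerBound_evolve θ i 1 G.horizon g' hM
    (fun s => by rw [hg', Function.update_of_ne (opp_ne i)])
    (fun s l hl h' => Filter.Eventually.of_forall fun a =>
      mul_le_mul_of_nonneg_left (G.valueFun_le_actionValue θ i s hl (hθ s (by omega)) h' a)
        zero_le_one) k t hk h
  simp only [one_mul] at hlb
  refine le_trans ?_ (hlb.le_expectation (G.measurable_costFrom i t _) he)
  rw [expectation_of_integrable hi]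
  exact_mod_cast G.integral_costFrom_le θ i t k h

theorem isPBE_betaStar (hθ : ∀ t, t < G.horizon → G.Solves θ t (G.cov θ t)) :
    G.IsPBE (G.betaStar θ) (G.beliefs θ) where
  markov := inferInstance
  rational := G.isSequentiallyRational_betaStar θ hθ
  consistent := G.isConsistent_betaStar θ

end Game

end LQG

end

theorem mainTheorem1 {n m : Fin 2 → ℕ} (G : LQG.Game n m) (θ : LQG.GenFun n m)
    (hθ : ∀ t, t < G.horizon → G.Solves θ t (G.cov θ t)) :
    ∃ μ : LQG.BeliefSystem n m,
      (∀ (i j : Fin 2), i ≠ j → ∀ t, t < G.horizon → ∀ h : LQG.PrivHist n m i t,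
        (μ i t h).map (fun h' => h'.2 (Fin.last t) j) = G.muStar θ j t h.1) ∧
      G.IsPBE (G.betaStar θ) μ :=
  ⟨G.beliefs θ, fun i j hij t _ h => G.beliefs_map_last θ i j hij t h,
    G.isPBE_betaStar θ hθ⟩
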